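/- For every integer $n\ge 1$ let $\Theta^{(n)}$ be a random vector uniformly distributed on the unit sphere $\mathbb S^{n-1}\subset\mathbb R^n$. For $\theta\in\mathbb R^n$ let $\mu_\theta$ be the law of $\langle U^{(n)},\theta\rangle$, where $U^{(n)}$ is uniformly distributed on the cube $[-1,1]^n$; thus $\mu_{\Theta^{(n)}}$ is a random element of the space $\mathcal M_1(\mathbb R)$ of Borel probability measures on $\mathbb R$ with the topology of weak convergence. Let $Z$ be a standard Gaussian random variable and $U_1,U_2,\dots$ uniform random variables on $[-1,1]$ such that $Z,U_1,U_2,\dots$ are independent. For every non-increasing sequence $\alpha_1\ge\alpha_2\ge\dots\ge 0$ of reals with $\|\alpha\|_2^2:=\sum_{k=1}^\infty\alpha_k^2<1$, the series $\sum_{k=1}^\infty\alpha_kU_k$ converges almost surely; let $\nu(\alpha)$ be the law of $$\sqrt{1-\|\alpha\|_2^2}\,\frac{Z}{\sqrt3}+\sum_{k=1}^\infty\alpha_kU_k .$$ Then there is a well-defined function $I:\mathcal M_1(\mathbb R)\to[0,+\infty]$ with $$I(\nu(\alpha))=-\tfrac12\log\bigl(1-\|\alpha\|_2^2\bigr)$$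 for all such $\alpha$, and $I(\nu)=+\infty$ for every $\nu\in\mathcal M_1(\mathbb R)$ that is not of the form $\nu(\alpha)$. It is lower semi-continuous, its sublevel sets $\{\nu: I(\nu)\le c\}$, $0\le c<\infty$, are compact (that is, $I$ is a good rate function), and $(\mu_{\Theta^{(n)}})_{n\ge1}$ satisfies the large deviation principle on $\mathcal M_1(\mathbb R)$ with speed $n$ and rate function $I$: for every Borel set $A\subset\mathcal M_1(\mathbb R)$, $$-\inf_{\nu\in A^\circ}I(\nu)\le\liminf_{n\to\infty}\frac1n\log\mathbb P[\mu_{\Theta^{(n)}}\in A]\le\limsup_{n\to\infty}\frac1n\log\mathbb P[\mu_{\Theta^{(n)}}\in A]\le-\inf_{\nu\in\overline A}I(\nu).$$ -/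

import Mathlib

open MeasureTheory ProbabilityTheory Filter Topology
open scoped ENNReal NNReal

noncomputable section

namespace CubeProjection

/-! ### Large deviation principles -/

/-- The sequence `(ξ n)`, `n ≥ 1`, of random elements of `M` (with `ξ n` defined on the probability
space `(Ω n, P n)`) satisfies a full large deviation principle with speed `s` and rate function `I`.
The terms with index `n = 0` play no role. Borel sets are those of the topology of `M`, and
`log 0 = -∞` in the extended reals. -/
structure SatisfiesLDP {M : Type*} [TopologicalSpace M] {Ω : ℕ → Type*}
    [∀ n, MeasurableSpace (Ω n)] (P : ∀ n, Measure (Ω n)) (ξ : ∀ n, Ω n → M)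
    (s : ℕ → ℝ) (I : M → ℝ≥0∞) : Prop where
  aemeasurable : ∀ n, 1 ≤ n → @AEMeasurable (Ω n) M (borel M) _ (ξ n) (P n)
  speed_pos : ∀ n, 1 ≤ n → 0 < s n
  speed_mono : Monotone s
  speed_tendsto : Tendsto s atTop atTop
  lowerSemicontinuous : LowerSemicontinuous I
  lower_bound : ∀ A : Set M, MeasurableSet[borel M] A →
    -(⨅ x ∈ interior A, (I x : EReal)) ≤
      liminf (fun n ↦ ENNReal.log (P n (ξ n ⁻¹' A)) / ((s n : ℝ) : EReal)) atTop
  upper_bound : ∀ A : Set M, MeasurableSet[borel M] A →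
    limsup (fun n ↦ ENNReal.log (P n (ξ n ⁻¹' A)) / ((s n : ℝ) : EReal)) atTop ≤
      -(⨅ x ∈ closure A, (I x : EReal))

/-- A rate function is good if its sublevel sets at finite levels are compact. -/
def IsGood {M : Type*} [TopologicalSpace M] (I : M → ℝ≥0∞) : Prop :=
  ∀ c : ℝ≥0, IsCompact {x | I x ≤ c}

/-! ### Uniform distributions and the projected measure -/

/-- The uniform distribution on the unit sphere `S^{n-1}` for `n ≥ 1`, as a measure on `ℝⁿ`: the
normalized surface measure. -/
def uniformSphere (n : ℕ) : Measure (EuclideanSpace ℝ (Fin n)) :=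
  Measure.map Subtype.val
    (((volume : Measure (EuclideanSpace ℝ (Fin n))).toSphere Set.univ)⁻¹ •
      (volume : Measure (EuclideanSpace ℝ (Fin n))).toSphere)

/-- The cube `[-1, 1]ⁿ`. -/
def cube (n : ℕ) : Set (EuclideanSpace ℝ (Fin n)) :=
  {u | ∀ i, u i ∈ Set.Icc (-1 : ℝ) 1}

/-- The uniform distribution on the cube `[-1, 1]ⁿ`: normalized Lebesgue measure. -/
def uniformCube (n : ℕ) : Measure (EuclideanSpace ℝ (Fin n)) :=
  ProbabilityTheory.cond volume (cube n)

theorem volume_cube (n : ℕ) : volume (cube n) = 2 ^ n := by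
  have h : cube n = (WithLp.ofLp : EuclideanSpace ℝ (Fin n) → (Fin n → ℝ)) ⁻¹'
      (Set.pi Set.univ fun _ ↦ Set.Icc (-1 : ℝ) 1) := by
    ext u; simp only [cube, Set.mem_ofPred_eq, Set.mem_preimage, Set.mem_univ_pi]
  rw [h, (PiLp.volume_preserving_ofLp (Fin n)).measure_preimage
    (MeasurableSet.univ_pi fun _ ↦ measurableSet_Icc).nullMeasurableSet, volume_pi_pi]
  simp only [Real.volume_Icc, Finset.prod_const, Finset.card_univ, Fintype.card_fin]
  norm_num

instance (n : ℕ) : IsProbabilityMeasure (uniformCube n) := by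
  unfold uniformCube
  refine cond_isProbabilityMeasure_of_finite ?_ ?_ <;> rw [volume_cube]
  · exact pow_ne_zero _ two_ne_zero
  · exact ENNReal.pow_ne_top ENNReal.ofNat_ne_top

/-- The measure `μ_θ`: the law of `⟨U, θ⟩` for `U` uniformly distributed on `[-1, 1]ⁿ`. -/
def projectedMeasure {n : ℕ} (θ : EuclideanSpace ℝ (Fin n)) : ProbabilityMeasure ℝ :=
  ⟨(uniformCube n).map (fun u ↦ inner ℝ u θ),
    Measure.isProbabilityMeasure_map (by fun_prop)⟩

/-! ### The measures `ν(α)` -/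

/-- Non-increasing sequences of non-negative reals with `‖α‖₂² < 1`. -/
def admissible : Set (ℕ → ℝ) :=
  {α | Antitone α ∧ (∀ k, 0 ≤ α k) ∧ Summable (fun k ↦ α k ^ 2) ∧ ∑' k, α k ^ 2 < 1}

/-- The uniform distribution on `[-1, 1]`. -/
def uniformInterval : Measure ℝ := ProbabilityTheory.cond volume (Set.Icc (-1 : ℝ) 1)

instance : IsProbabilityMeasure uniformInterval := by
  unfold uniformInterval
  refine cond_isProbabilityMeasure_of_finite ?_ ?_ <;> rw [Real.volume_Icc] <;> norm_num

/-- The joint law of `(Z, (U_k)_k)`, all independent, with `Z` standard Gaussian and each `U_k`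
uniform on `[-1, 1]`. -/
def jointLaw : Measure (ℝ × (ℕ → ℝ)) :=
  (gaussianReal 0 1).prod (Measure.infinitePi fun _ : ℕ ↦ uniformInterval)

instance : IsProbabilityMeasure jointLaw := by
  unfold jointLaw; infer_instance

/-- Partial sums of `∑ α_k U_k`. -/
def partialSum (α : ℕ → ℝ) (n : ℕ) (ω : ℝ × (ℕ → ℝ)) : ℝ :=
  ∑ k ∈ Finset.range n, α k * ω.2 k

/-- The random variable `√(1 - ‖α‖₂²) Z / √3 + ∑ α_k U_k`; the series is the limit of its partial
sums (it need not converge absolutely). -/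
def limitVariable (α : ℕ → ℝ) (ω : ℝ × (ℕ → ℝ)) : ℝ :=
  √(1 - ∑' k, α k ^ 2) * (ω.1 / √3) + limUnder atTop (fun n ↦ partialSum α n ω)

theorem measurable_limitVariable (α : ℕ → ℝ) : Measurable (limitVariable α) := by
  unfold limitVariable
  refine Measurable.add (by fun_prop) ?_
  refine (StronglyMeasurable.limUnder fun n ↦ ?_).measurable
  refine Measurable.stronglyMeasurable ?_
  unfold partialSum
  fun_prop

/-- The probability measure `ν(α)`. -/
def nu (α : ℕ → ℝ) : ProbabilityMeasure ℝ :=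
  ⟨jointLaw.map (limitVariable α),
    Measure.isProbabilityMeasure_map (measurable_limitVariable α).aemeasurable⟩

end CubeProjection

end

namespace CubeProjection

/-! ### The uniform distribution on `[-1, 1]` and the random series -/

/-! Let `sequences` be the non-increasing non-negative sequences with norm at most one, in the
product topology; this space is compact. Sorting the absolute values of the coordinates of a unit
vector `θ` gives a point of it, and `μ_θ` is `nu` of that point, because norm one leaves no Gaussian
part (`nu_rearrangement`). The theorem is therefore a statement about the largest coordinates of a
uniform point of the sphere, transported by `nu`.

The transport needs two facts. `nu` is continuous on `sequences` (`continuous_nu_sequences`):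
replacing the tail of the series by a Gaussian of the same variance changes the characteristic
function at `t` by at most `2|t|³ a n`, which is uniformly small since `a n ≤ 1/√(n+1)`. Norm that
escapes in a coordinatewise limit thus reappears as Gaussian variance. And `nu` is injective
(`injOn_nu_sequences`): at the first index where two sequences differ, the larger entry produces a
zero of the characteristic function that the other one does not account for. Injectivity makes the
rate function well defined, and compactness makes it good.

On the sphere, the event that `m` given coordinates carry more than a share `q` of the squared norm
has probability of exponential order `(1-q)^(n/2)`. This comes from comparing volumes of cones with
products of balls, using only how volumes scale. A union bound over the `n.choose m ≤ n^m` choices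
costs nothing at exponential scale. For the matching lower bound, the first `m` coordinates are put
in a small box, and the event that some other coordinate is not small is removed: it has a strictly
smaller exponential rate. Finitely many coordinates suffice in both directions, by compactness for
closed sets (`exists_forall_lt_sum`) and by the product topology for open ones
(`exists_forall_nu_mem`). -/

theorem integral_uniformInterval {E : Type*} [NormedAddCommGroup E] [NormedSpace ℝ E] (f : ℝ → E) :
    ∫ x, f x ∂uniformInterval = (1 / 2 : ℝ) • ∫ x in (-1)..1, f x := by
  rw [uniformInterval, ProbabilityTheory.cond, integral_smul_measure,
    intervalIntegral.integral_of_le (by norm_num), integral_Icc_eq_integral_Ioc, Real.volume_Icc]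
  norm_num

theorem integral_id_uniformInterval : ∫ x, x ∂uniformInterval = 0 := by
  rw [integral_uniformInterval]; norm_num

theorem charFun_uniformInterval (t : ℝ) : charFun uniformInterval t = (Real.sinc t : ℂ) := by
  rw [charFun_apply_real, integral_uniformInterval]
  rcases eq_or_ne t 0 with rfl | ht
  · norm_num
  have h := intervalIntegral.integral_comp_mul_left (a := -1) (b := 1)
    (fun x : ℝ ↦ Complex.exp (x * Complex.I)) ht
  simp only [Complex.ofReal_mul, mul_neg, mul_one] at h
  rw [h, integral_exp_mul_I_eq_sinc]
  have : (t : ℂ) ≠ 0 := by exact_mod_cast ht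
  simp only [Complex.real_smul]
  push_cast
  field_simp

theorem ae_mem_Icc_uniformInterval : ∀ᵐ x ∂uniformInterval, x ∈ Set.Icc (-1 : ℝ) 1 :=
  ae_cond_mem measurableSet_Icc

/-- The coordinate law `⊗ₖ Unif[-1,1]`. -/
noncomputable def coordinateLaw : Measure (ℕ → ℝ) := Measure.infinitePi fun _ : ℕ ↦ uniformInterval

instance : IsProbabilityMeasure coordinateLaw := by unfold coordinateLaw; infer_instance

theorem map_eval_coordinateLaw (k : ℕ) :
    coordinateLaw.map (fun ω ↦ ω k) = uniformInterval :=
  Measure.infinitePi_map_eval (fun _ : ℕ ↦ uniformInterval) k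

theorem iIndepFun_coordinateLaw (a : ℕ → ℝ) :
    iIndepFun (fun k (ω : ℕ → ℝ) ↦ a k * ω k) coordinateLaw :=
  iIndepFun_infinitePi (X := fun k x ↦ a k * x) (fun k ↦ by fun_prop)

theorem ae_mem_Icc_coordinateLaw (k : ℕ) : ∀ᵐ ω ∂coordinateLaw, ω k ∈ Set.Icc (-1 : ℝ) 1 := by
  have h := ae_mem_Icc_uniformInterval
  rw [← map_eval_coordinateLaw k] at h
  exact ae_of_ae_map (measurable_pi_apply k).aemeasurable h

theorem memLp_coordinate (a : ℕ → ℝ) (k : ℕ) (p : ℝ≥0∞) :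
    MemLp (fun ω : ℕ → ℝ ↦ a k * ω k) p coordinateLaw := by
  refine MemLp.const_mul ?_ _
  refine MemLp.of_bound (measurable_pi_apply k).aestronglyMeasurable 1 ?_
  filter_upwards [ae_mem_Icc_coordinateLaw k] with ω hω
  rw [Real.norm_eq_abs]
  exact abs_le.2 hω

theorem integral_coordinate (a : ℕ → ℝ) (k : ℕ) :
    ∫ ω, a k * ω k ∂coordinateLaw = 0 := by
  rw [integral_const_mul]
  have := integral_map (μ := coordinateLaw) (φ := fun ω ↦ ω k) (f := fun x : ℝ ↦ x)
    (measurable_pi_apply k).aemeasurable (by fun_prop)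
  rw [← this, map_eval_coordinateLaw, integral_id_uniformInterval, mul_zero]

theorem variance_coordinate_le (a : ℕ → ℝ) (k : ℕ) :
    variance (fun ω ↦ a k * ω k) coordinateLaw ≤ a k ^ 2 := by
  rw [variance_const_mul]
  have h := variance_le_sq_of_bounded (μ := coordinateLaw) (X := fun ω ↦ ω k)
    (a := -1) (b := 1) (ae_mem_Icc_coordinateLaw k) (measurable_pi_apply k).aemeasurable
  norm_num at h
  nlinarith [sq_nonneg (a k)]

/-- Uses `|x| ≤ 1 + x²` and additivity of variance. It provides the `L¹` bound for martingale
convergence. -/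
theorem integral_abs_sum_le (a : ℕ → ℝ) (n : ℕ) :
    ∫ ω, |∑ k ∈ Finset.range n, a k * ω k| ∂coordinateLaw ≤
      1 + ∑ k ∈ Finset.range n, a k ^ 2 := by
  have hmem : MemLp (fun ω : ℕ → ℝ ↦ ∑ k ∈ Finset.range n, a k * ω k) 2 coordinateLaw :=
    memLp_finsetSum _ fun k _ ↦ memLp_coordinate a k 2
  have hzero : ∫ ω, ∑ k ∈ Finset.range n, a k * ω k ∂coordinateLaw = 0 := by
    rw [integral_finsetSum _ fun k _ ↦ (memLp_coordinate a k 1).integrable le_rfl]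
    exact Finset.sum_eq_zero fun k _ ↦ integral_coordinate a k
  have hvar : ∫ ω, (∑ k ∈ Finset.range n, a k * ω k) ^ 2 ∂coordinateLaw ≤
      ∑ k ∈ Finset.range n, a k ^ 2 := by
    rw [← variance_of_integral_eq_zero hmem.aemeasurable hzero]
    have := IndepFun.variance_sum (μ := coordinateLaw) (s := Finset.range n)
      (X := fun k ω ↦ a k * ω k) (fun k _ ↦ memLp_coordinate a k 2)
      (fun i _ j _ hij ↦ (iIndepFun_coordinateLaw a).indepFun hij)
    have h2 : (∑ k ∈ Finset.range n, fun ω : ℕ → ℝ ↦ a k * ω k) =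
        fun ω ↦ ∑ k ∈ Finset.range n, a k * ω k := by ext; simp
    rw [h2] at this
    rw [this]
    exact Finset.sum_le_sum fun k _ ↦ variance_coordinate_le a k
  calc ∫ ω, |∑ k ∈ Finset.range n, a k * ω k| ∂coordinateLaw
      ≤ ∫ ω, (1 + (∑ k ∈ Finset.range n, a k * ω k) ^ 2) ∂coordinateLaw := by
        refine integral_mono (hmem.integrable one_le_two).abs
          ((integrable_const _).add hmem.integrable_sq) fun ω ↦ ?_
        simp only
        rw [← sq_abs]
        nlinarith [sq_nonneg (|∑ k ∈ Finset.range n, a k * ω k| - 1)]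
    _ = 1 + ∫ ω, (∑ k ∈ Finset.range n, a k * ω k) ^ 2 ∂coordinateLaw := by
        rw [integral_add (integrable_const _) hmem.integrable_sq]; simp
    _ ≤ _ := by gcongr

/-- The partial sums form an `L¹`-bounded martingale, so they converge almost surely. -/
theorem ae_tendsto_series {a : ℕ → ℝ} (ha : Summable fun k ↦ a k ^ 2) :
    ∀ᵐ ω ∂coordinateLaw, ∃ l : ℝ,
      Tendsto (fun n ↦ ∑ k ∈ Finset.range n, a k * ω k) atTop (𝓝 l) := by
  set f : ℕ → (ℕ → ℝ) → ℝ := fun k ω ↦ a k * ω k with hf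
  have hfm : ∀ k, StronglyMeasurable (f k) := fun k ↦ by
    refine Measurable.stronglyMeasurable ?_; fun_prop
  have hfi : iIndepFun f coordinateLaw := iIndepFun_coordinateLaw a
  -- The sum runs up to index `n` inclusive, so that each increment `f (n + 1)` is independent of
  -- the natural filtration at time `n`.
  set M : ℕ → (ℕ → ℝ) → ℝ := fun n ω ↦ ∑ k ∈ Finset.range (n + 1), f k ω with hM
  have hint : ∀ n, Integrable (M n) coordinateLaw := fun n ↦
    integrable_finsetSum _ fun k _ ↦ (memLp_coordinate a k 1).integrable le_rfl
  have hmart : Martingale M (Filtration.natural f hfm) coordinateLaw := by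
    refine martingale_of_condExp_sub_eq_zero_nat (fun n ↦ ?_) hint fun n ↦ ?_
    · refine Finset.stronglyMeasurable_fun_sum _ fun k hk ↦ ?_
      exact (Filtration.stronglyAdapted_natural hfm k).mono
        (Filtration.mono _ (by simpa [Nat.lt_succ_iff] using hk))
    · have hsub : M (n + 1) - M n = f (n + 1) := by
        ext ω; simp [hM, Finset.sum_range_succ _ (n + 1)]
      rw [hsub]
      filter_upwards [hfi.condExp_natural_ae_eq_of_lt hfm n.lt_succ_self] with ω hω
      rw [hω]
      exact integral_coordinate a (n + 1)
  have hbdd : ∀ n, eLpNorm (M n) 1 coordinateLaw ≤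
      ((1 + ∑' k, a k ^ 2).toNNReal : ℝ≥0∞) := fun n ↦ by
    rw [eLpNorm_one_eq_lintegral_enorm, ← ofReal_integral_norm_eq_lintegral_enorm (hint n)]
    refine ENNReal.ofReal_le_ofReal ?_
    refine (integral_abs_sum_le a (n + 1)).trans ?_
    gcongr
    exact ha.sum_le_tsum _ fun k _ ↦ sq_nonneg _
  filter_upwards [hmart.submartingale.exists_ae_tendsto_of_bdd hbdd] with ω ⟨l, hl⟩
  exact ⟨l, (tendsto_add_atTop_iff_nat 1).1 hl⟩

theorem ae_tendsto_partialSum {a : ℕ → ℝ} (ha : Summable fun k ↦ a k ^ 2) :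
    ∀ᵐ ω ∂jointLaw, ∃ l : ℝ, Tendsto (fun n ↦ partialSum a n ω) atTop (𝓝 l) :=
  Measure.quasiMeasurePreserving_snd.ae (ae_tendsto_series ha)

/-! ### Characteristic functions -/

theorem charFun_coordinate (a : ℕ → ℝ) (k : ℕ) (t : ℝ) :
    charFun (coordinateLaw.map fun ω ↦ a k * ω k) t = (Real.sinc (a k * t) : ℂ) := by
  have : (coordinateLaw.map fun ω ↦ a k * ω k) = uniformInterval.map (a k * ·) := by
    rw [← map_eval_coordinateLaw k, Measure.map_map (by fun_prop) (by fun_prop)]; rfl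
  rw [this, charFun_map_mul, charFun_uniformInterval]

theorem charFun_sum_coordinate (a : ℕ → ℝ) (n : ℕ) (t : ℝ) :
    charFun (coordinateLaw.map fun ω ↦ ∑ k ∈ Finset.range n, a k * ω k) t =
      ∏ k ∈ Finset.range n, (Real.sinc (a k * t) : ℂ) := by
  have h := iIndepFun.charFun_map_fun_finsetSum_eq_prod (P := coordinateLaw)
    (s := Finset.range n) (X := fun k ω ↦ a k * ω k) (fun k _ ↦ Measurable.aemeasurable (by fun_prop))
    ((iIndepFun_coordinateLaw a).restrict _)
  rw [h, Finset.prod_apply]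
  exact Finset.prod_congr rfl fun k _ ↦ charFun_coordinate a k t

theorem integral_exp_partialSum (c : ℝ) (a : ℕ → ℝ) (n : ℕ) (t : ℝ) :
    ∫ ω, Complex.exp (t * (c * (ω.1 / √3) + partialSum a n ω : ℝ) * Complex.I) ∂jointLaw =
      (Real.exp (-(c ^ 2 * t ^ 2 / 6)) * ∏ k ∈ Finset.range n, Real.sinc (a k * t) : ℝ) := by
  have h : ∀ ω : ℝ × (ℕ → ℝ),
      Complex.exp (t * (c * (ω.1 / √3) + partialSum a n ω : ℝ) * Complex.I) =
        Complex.exp ((t * (c / √3) : ℝ) * ω.1 * Complex.I) *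
          Complex.exp (t * (∑ k ∈ Finset.range n, a k * ω.2 k : ℝ) * Complex.I) := fun ω ↦ by
    rw [← Complex.exp_add, partialSum]
    congr 1
    push_cast
    ring
  simp_rw [h]
  rw [jointLaw, integral_prod_mul
    (fun x : ℝ ↦ Complex.exp ((t * (c / √3) : ℝ) * x * Complex.I))
    (fun y : ℕ → ℝ ↦ Complex.exp (t * (∑ k ∈ Finset.range n, a k * y k : ℝ) * Complex.I)),
    ← charFun_apply_real, charFun_gaussianReal]
  have h2 := charFun_sum_coordinate a n t
  rw [charFun_apply_real, integral_map (Measurable.aemeasurable (by fun_prop)) (by fun_prop)] at h2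
  rw [coordinateLaw] at h2
  rw [h2]
  push_cast
  congr 2
  have h3 : ((√3 : ℝ) : ℂ) ^ 2 = 3 := by
    rw [← Complex.ofReal_pow, Real.sq_sqrt (by norm_num)]; norm_num
  simp only [mul_pow, div_pow, h3]
  ring_nf

/-- Dominated convergence. Norm exactly one is allowed because sorted unit vectors have it. -/
theorem tendsto_charFun_nu {a : ℕ → ℝ} (ha : Summable fun k ↦ a k ^ 2)
    (ha1 : ∑' k, a k ^ 2 ≤ 1) (t : ℝ) :
    Tendsto (fun n ↦ ((Real.exp (-((1 - ∑' k, a k ^ 2) * t ^ 2 / 6)) *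
      ∏ k ∈ Finset.range n, Real.sinc (a k * t) : ℝ) : ℂ)) atTop (𝓝 (charFun (nu a : Measure ℝ) t)) := by
  have hs : √(1 - ∑' k, a k ^ 2) ^ 2 = 1 - ∑' k, a k ^ 2 := Real.sq_sqrt (by linarith)
  rw [← hs]
  simp_rw [← integral_exp_partialSum]
  have : charFun (nu a : Measure ℝ) t =
      ∫ ω, Complex.exp (t * (limitVariable a ω : ℝ) * Complex.I) ∂jointLaw := by
    rw [charFun_apply_real]
    exact integral_map (measurable_limitVariable a).aemeasurable (by fun_prop)
  rw [this]
  refine tendsto_integral_of_dominated_convergence (fun _ ↦ 1) (fun n ↦ ?_) (integrable_const _)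
    (fun n ↦ ae_of_all _ fun ω ↦ ?_) ?_
  · unfold partialSum; fun_prop
  · rw [← Complex.ofReal_mul, Complex.norm_exp_ofReal_mul_I]
  · filter_upwards [ae_tendsto_partialSum ha] with ω hω
    have h := tendsto_nhds_limUnder hω
    have hc : Continuous fun x : ℝ ↦ Complex.exp (t * (x : ℝ) * Complex.I) := by fun_prop
    exact (hc.tendsto _).comp (h.const_add _)

/-! ### The compact space of sequences of norm at most one -/

/-- Non-increasing sequences of non-negative reals with `‖a‖₂ ≤ 1`. -/
def sequences : Set (ℕ → ℝ) :=
  {a | Antitone a ∧ (∀ k, 0 ≤ a k) ∧ ∀ n, ∑ k ∈ Finset.range n, a k ^ 2 ≤ 1}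

section sequences

variable {a b : ℕ → ℝ}

theorem summable_of_mem_sequences (ha : a ∈ sequences) : Summable fun k ↦ a k ^ 2 :=
  summable_of_sum_range_le (fun _ ↦ sq_nonneg _) ha.2.2

theorem tsum_le_of_mem_sequences (ha : a ∈ sequences) : ∑' k, a k ^ 2 ≤ 1 :=
  (summable_of_mem_sequences ha).tsum_le_of_sum_range_le ha.2.2

theorem mem_sequences_of_mem_admissible (ha : a ∈ admissible) : a ∈ sequences :=
  ⟨ha.1, ha.2.1, fun _ ↦ (ha.2.2.1.sum_le_tsum _ fun _ _ ↦ sq_nonneg _).trans ha.2.2.2.le⟩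

theorem mem_admissible_of_mem_sequences (ha : a ∈ sequences) (h : ∑' k, a k ^ 2 < 1) :
    a ∈ admissible :=
  ⟨ha.1, ha.2.1, summable_of_mem_sequences ha, h⟩

/-- The first `n + 1` squares are all at least `a n ^ 2` and sum to at most one. -/
theorem le_inv_sqrt_of_mem_sequences (ha : a ∈ sequences) (n : ℕ) : a n ≤ 1 / √(n + 1) := by
  have h : (n + 1) * a n ^ 2 ≤ 1 := by
    refine le_trans ?_ (ha.2.2 (n + 1))
    have : ∑ k ∈ Finset.range (n + 1), a n ^ 2 ≤ ∑ k ∈ Finset.range (n + 1), a k ^ 2 := by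
      refine Finset.sum_le_sum fun k hk ↦ ?_
      have := ha.1 (Nat.lt_succ_iff.1 (Finset.mem_range.1 hk))
      have := ha.2.1 n
      gcongr
    simpa using this
  rw [one_div, ← Real.sqrt_inv]
  refine Real.le_sqrt_of_sq_le ?_
  rwa [← one_div, le_div_iff₀' (by positivity)]

/-- Every condition, including the norm bound through partial sums, involves finitely many
coordinates and is closed, so this is a closed subset of the compact cube `[0,1]^ℕ`. -/
theorem isCompact_sequences : IsCompact sequences := by
  refine (isCompact_univ_pi fun _ : ℕ ↦ isCompact_Icc (a := (0 : ℝ)) (b := 1)).of_isClosed_subset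
    ?_ ?_
  · have : sequences = {a | ∀ i j, i ≤ j → a j ≤ a i} ∩ ({a | ∀ k, 0 ≤ a k} ∩
        {a | ∀ n, ∑ k ∈ Finset.range n, a k ^ 2 ≤ 1}) := rfl
    rw [this]
    simp only [Set.ofPred_forall]
    refine (isClosed_iInter fun i ↦ isClosed_iInter fun j ↦ isClosed_iInter fun _ ↦ ?_).inter
      ((isClosed_iInter fun k ↦ ?_).inter (isClosed_iInter fun n ↦ ?_))
    · exact isClosed_le (by fun_prop) (by fun_prop)
    · exact isClosed_le (by fun_prop) (by fun_prop)
    · exact isClosed_le (by fun_prop) (by fun_prop)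
  · intro a ha k _
    refine ⟨ha.2.1 k, (le_inv_sqrt_of_mem_sequences ha k).trans ?_⟩
    rw [div_le_one (by positivity), Real.one_le_sqrt]
    linarith [(Nat.cast_nonneg k : (0 : ℝ) ≤ k)]

/-! ### Approximation of the characteristic function -/

/-- The characteristic function of the law in which the terms of the series from `n` on are
replaced by Gaussian ones. -/
noncomputable def charApprox (t : ℝ) (n : ℕ) (a : ℕ → ℝ) : ℝ :=
  Real.exp (-((1 - ∑ k ∈ Finset.range n, a k ^ 2) * t ^ 2 / 6)) *
    ∏ k ∈ Finset.range n, Real.sinc (a k * t)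

/-- Both functions are `1 - x²/6` up to a higher-order error near zero; for `|x| ≥ 1` the trivial
bound `2` suffices. -/
theorem abs_sinc_sub_exp_le (x : ℝ) : |Real.sinc x - Real.exp (-(x ^ 2 / 6))| ≤ 2 * |x| ^ 3 := by
  wlog hx : 0 ≤ x generalizing x
  · have := this (-x) (by linarith)
    rwa [Real.sinc_neg, neg_sq, abs_neg] at this
  rcases hx.eq_or_lt with rfl | hx
  · simp
  rw [abs_of_pos hx]
  rcases le_total 1 x with h1 | h1
  · have e1 : Real.exp (-(x ^ 2 / 6)) ≤ 1 := Real.exp_le_one_iff.2 (by nlinarith)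
    have e2 := Real.exp_pos (-(x ^ 2 / 6))
    have s := abs_le.1 (Real.abs_sinc_le_one x)
    have : 1 ≤ x ^ 3 := one_le_pow₀ h1
    rw [abs_le]; constructor <;> linarith
  · have s1 := Real.sin_gt_sub_cube hx
    have s2 := (abs_le.1 (Real.sin_bound (abs_le.2 ⟨by linarith, h1⟩))).2
    rw [abs_of_pos hx] at s2
    have s3 : 1 - x ^ 2 / 6 ≤ Real.sinc x := by
      rw [Real.sinc_of_ne_zero hx.ne', le_div_iff₀ hx]; nlinarith
    have s4 : Real.sinc x ≤ 1 - x ^ 2 / 6 + x ^ 3 := by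
      rw [Real.sinc_of_ne_zero hx.ne', div_le_iff₀ hx]; nlinarith [pow_pos hx 4]
    have e1 := Real.add_one_le_exp (-(x ^ 2 / 6))
    have e2 := (abs_le.1 (Real.abs_exp_sub_one_sub_id_le (x := -(x ^ 2 / 6))
      (abs_le.2 ⟨by nlinarith, by nlinarith⟩))).2
    have h4 : x ^ 4 ≤ x ^ 3 := by nlinarith [pow_pos hx 3]
    rw [abs_le]; constructor <;> nlinarith [pow_pos hx 3]

theorem abs_prod_sinc_le_one (a : ℕ → ℝ) (t : ℝ) (s : Finset ℕ) :
    |∏ k ∈ s, Real.sinc (a k * t)| ≤ 1 := by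
  rw [Finset.abs_prod]
  exact Finset.prod_le_one (fun _ _ ↦ abs_nonneg _) fun _ _ ↦ Real.abs_sinc_le_one _

/-- One Lindeberg replacement: a uniform term is exchanged for a Gaussian one of equal variance `a n
^ 2 / 3`, and all other factors have modulus at most one. -/
theorem abs_charApprox_succ_sub_le (ha : a ∈ sequences) (t : ℝ) (n : ℕ) :
    |charApprox t (n + 1) a - charApprox t n a| ≤ 2 * |a n * t| ^ 3 := by
  have h : charApprox t (n + 1) a - charApprox t n a =
      Real.exp (-((1 - ∑ k ∈ Finset.range (n + 1), a k ^ 2) * t ^ 2 / 6)) *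
        (∏ k ∈ Finset.range n, Real.sinc (a k * t)) *
        (Real.sinc (a n * t) - Real.exp (-((a n * t) ^ 2 / 6))) := by
    have : Real.exp (-((1 - ∑ k ∈ Finset.range n, a k ^ 2) * t ^ 2 / 6)) =
        Real.exp (-((1 - ∑ k ∈ Finset.range (n + 1), a k ^ 2) * t ^ 2 / 6)) *
          Real.exp (-((a n * t) ^ 2 / 6)) := by
      rw [← Real.exp_add, Finset.sum_range_succ]; ring_nf
    rw [charApprox, charApprox, this, Finset.prod_range_succ]; ring
  have h1 := ha.2.2 (n + 1)
  rw [h, abs_mul, abs_mul, Real.abs_exp]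
  refine (mul_le_of_le_one_left (abs_nonneg _) ?_).trans (abs_sinc_sub_exp_le _)
  refine mul_le_one₀ (Real.exp_le_one_iff.2 ?_) (abs_nonneg _) (abs_prod_sinc_le_one a t _)
  have : 0 ≤ 1 - ∑ k ∈ Finset.range (n + 1), a k ^ 2 := by linarith
  have := mul_nonneg this (sq_nonneg t)
  linarith

/-- Telescoping leaves a tail of cubes, and monotonicity gives `∑ a k ^ 3 ≤ a n * ∑ a k ^ 2 ≤ a n`.
-/
theorem abs_charApprox_sub_le (ha : a ∈ sequences) (t : ℝ) {n m : ℕ} (h : n ≤ m) :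
    |charApprox t m a - charApprox t n a| ≤ 2 * |t| ^ 3 * a n := by
  have h1 : |charApprox t m a - charApprox t n a| ≤ ∑ k ∈ Finset.Ico n m, 2 * |a k * t| ^ 3 := by
    rw [← Finset.sum_Ico_sub (fun k ↦ charApprox t k a) h]
    exact (Finset.abs_sum_le_sum_abs _ _).trans
      (Finset.sum_le_sum fun k _ ↦ abs_charApprox_succ_sub_le ha t k)
  have h2 : ∀ k ∈ Finset.Ico n m, 2 * |a k * t| ^ 3 ≤ 2 * |t| ^ 3 * a n * a k ^ 2 := by
    intro k hk
    have h3 : a k ≤ a n := ha.1 (Finset.mem_Ico.1 hk).1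
    have h4 := ha.2.1 k
    rw [abs_mul, abs_of_nonneg h4, mul_pow]
    have : 0 ≤ 2 * |t| ^ 3 * a k ^ 2 := by positivity
    nlinarith
  refine h1.trans ((Finset.sum_le_sum h2).trans ?_)
  rw [← Finset.mul_sum]
  have h5 : ∑ k ∈ Finset.Ico n m, a k ^ 2 ≤ 1 := by
    refine le_trans (Finset.sum_le_sum_of_subset_of_nonneg ?_ fun _ _ _ ↦ sq_nonneg _) (ha.2.2 m)
    intro k hk
    simp at hk ⊢; exact hk.2
  have := ha.2.1 n
  exact mul_le_of_le_one_right (by positivity) h5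

theorem tendsto_charApprox (ha : a ∈ sequences) (t : ℝ) :
    Tendsto (fun n ↦ (charApprox t n a : ℂ)) atTop (𝓝 (charFun (nu a : Measure ℝ) t)) := by
  have hs := summable_of_mem_sequences ha
  have h := tendsto_charFun_nu hs (tsum_le_of_mem_sequences ha) t
  set E := Real.exp (-((1 - ∑' k, a k ^ 2) * t ^ 2 / 6)) with hE
  have hE0 : E ≠ 0 := (Real.exp_pos _).ne'
  -- The two approximations differ only in the Gaussian prefactor, with a partial sum in place of
  -- the full series; the ratio of prefactors tends to one.
  have h1 : Tendsto (fun n ↦ Real.exp (-((1 - ∑ k ∈ Finset.range n, a k ^ 2) * t ^ 2 / 6)) / E)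
      atTop (𝓝 1) := by
    suffices h : Tendsto (fun n ↦ Real.exp (-((1 - ∑ k ∈ Finset.range n, a k ^ 2) * t ^ 2 / 6)))
        atTop (𝓝 E) by simpa [hE0] using h.div_const E
    have hc : Continuous fun x : ℝ ↦ Real.exp (-((1 - x) * t ^ 2 / 6)) := by fun_prop
    exact (hc.tendsto _).comp hs.hasSum.tendsto_sum_nat
  have h2 := ((Complex.continuous_ofReal.tendsto _).comp h1).mul h
  rw [Complex.ofReal_one, one_mul] at h2
  refine h2.congr fun n ↦ ?_
  rw [Function.comp_apply, ← Complex.ofReal_mul, charApprox]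
  congr 1
  field_simp

theorem norm_charFun_sub_charApprox_le (ha : a ∈ sequences) (t : ℝ) (n : ℕ) :
    ‖charFun (nu a : Measure ℝ) t - charApprox t n a‖ ≤ 2 * |t| ^ 3 * (1 / √(n + 1)) := by
  refine le_trans ?_ (mul_le_mul_of_nonneg_left (le_inv_sqrt_of_mem_sequences ha n)
    (by positivity : 0 ≤ 2 * |t| ^ 3))
  refine le_of_tendsto ((tendsto_charApprox ha t).sub_const _).norm ?_
  filter_upwards [eventually_ge_atTop n] with m hm
  rw [← Complex.ofReal_sub, Complex.norm_real, Real.norm_eq_abs]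
  exact abs_charApprox_sub_le ha t hm

/-- A uniform limit of functions of finitely many coordinates. -/
theorem continuousOn_charFun_nu (t : ℝ) :
    ContinuousOn (fun a ↦ charFun (nu a : Measure ℝ) t) sequences := by
  have hu : TendstoUniformlyOn (fun n a ↦ (charApprox t n a : ℂ))
      (fun a ↦ charFun (nu a : Measure ℝ) t) atTop sequences := by
    rw [Metric.tendstoUniformlyOn_iff]
    intro ε hε
    have h0 : Tendsto (fun n : ℕ ↦ 2 * |t| ^ 3 * (1 / √((n : ℝ) + 1))) atTop (𝓝 0) := by
      suffices h : Tendsto (fun n : ℕ ↦ (√((n : ℝ) + 1))⁻¹) atTop (𝓝 0) by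
        simpa using h.const_mul (2 * |t| ^ 3)
      refine tendsto_inv_atTop_zero.comp (Real.tendsto_sqrt_atTop.comp ?_)
      exact tendsto_atTop_add_const_right _ _ tendsto_natCast_atTop_atTop
    filter_upwards [h0.eventually_lt_const hε] with n hn a ha
    rw [dist_eq_norm]
    exact (norm_charFun_sub_charApprox_le ha t n).trans_lt hn
  refine hu.continuousOn (Eventually.of_forall fun n ↦ Continuous.continuousOn ?_).frequently
  refine Complex.continuous_ofReal.comp ?_
  unfold charApprox
  refine Continuous.mul (by fun_prop) (continuous_finsetProd _ fun k _ ↦ ?_)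
  exact Real.continuous_sinc.comp (by fun_prop)

theorem continuous_nu_sequences : Continuous fun a : sequences ↦ nu a := by
  rw [continuous_iff_seqContinuous]
  intro u a hu
  rw [Function.comp_def, ProbabilityMeasure.tendsto_iff_tendsto_charFun]
  intro t
  exact ((continuousOn_charFun_nu t).domRestrict.tendsto a).comp hu

/-! ### Injectivity -/

/-- A Gaussian minorant before the first zero of `sinc`. It turns an infinite product of `sinc`
factors into an exponential of a sum of squares, which is bounded on `sequences`. -/
theorem exists_exp_le_sinc {x₁ : ℝ} (hx₁ : x₁ < Real.pi) :
    ∃ C, 0 ≤ C ∧ ∀ x, 0 ≤ x → x ≤ x₁ → Real.exp (-(C * x ^ 2)) ≤ Real.sinc x := by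
  rcases lt_or_ge x₁ 0 with h | h
  · exact ⟨0, le_rfl, fun x h1 h2 ↦ by linarith⟩
  obtain ⟨x₀, hx₀, hmin⟩ := (isCompact_Icc (a := 0) (b := x₁)).exists_isMinOn
    (Set.nonempty_Icc.2 h) Real.continuous_sinc.continuousOn
  have hm : 0 < Real.sinc x₀ := by
    rcases hx₀.1.eq_or_lt with h0 | h0
    · rw [← h0]; simp
    · rw [Real.sinc_of_ne_zero h0.ne']
      exact div_pos (Real.sin_pos_of_pos_of_lt_pi h0 (hx₀.2.trans_lt hx₁)) h0
  -- The constant `1` serves on `[0, 1]`, through the Taylor bound; the logarithm of the minimum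
  -- serves beyond `1`.
  refine ⟨max 1 (-Real.log (Real.sinc x₀)), by positivity, fun x h0 h1 ↦ ?_⟩
  rcases le_total x 1 with hx | hx
  · rcases h0.eq_or_lt with rfl | h0
    · simp
    have h2 : Real.exp (-(max 1 (-Real.log (Real.sinc x₀)) * x ^ 2)) ≤ Real.exp (-x ^ 2) := by
      refine Real.exp_le_exp.2 ?_
      nlinarith [le_max_left 1 (-Real.log (Real.sinc x₀)), sq_nonneg x]
    have h3 : 1 - x ^ 2 / 6 ≤ Real.sinc x := by
      rw [Real.sinc_of_ne_zero h0.ne', le_div_iff₀ h0]; nlinarith [Real.sin_gt_sub_cube h0]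
    have h4 : Real.exp (-x ^ 2) ≤ 1 - x ^ 2 / 6 := by
      rw [Real.exp_neg]
      refine inv_le_of_inv_le₀ (by nlinarith) (le_trans ?_ (Real.add_one_le_exp (x ^ 2)))
      rw [inv_le_iff_one_le_mul₀ (by nlinarith)]
      nlinarith [mul_nonneg (sq_nonneg x) (by nlinarith : 0 ≤ 1 - x ^ 2)]
    exact h2.trans (h4.trans h3)
  · refine le_trans ?_ (hmin ⟨h0, h1⟩)
    rw [← Real.le_log_iff_exp_le hm]
    have h2 := le_max_right 1 (-Real.log (Real.sinc x₀))
    have h3 : 0 < max 1 (-Real.log (Real.sinc x₀)) := by positivity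
    nlinarith [mul_nonneg h3.le (by nlinarith : 0 ≤ x ^ 2 - 1)]

theorem countable_sinc_zeros (c : ℝ) : {t : ℝ | Real.sinc (c * t) = 0}.Countable := by
  refine (Set.countable_range fun n : ℤ ↦ (n * Real.pi) / c).mono fun t ht ↦ ?_
  have h0 : c * t ≠ 0 := fun h ↦ by simp [h] at ht
  have hc : c ≠ 0 := left_ne_zero_of_mul h0
  rw [Set.mem_ofPred_eq, Real.sinc_of_ne_zero h0, div_eq_zero_iff, or_iff_left h0,
    Real.sin_eq_zero_iff] at ht
  obtain ⟨n, hn⟩ := ht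
  exact ⟨n, by simp only [hn]; field_simp⟩

theorem dense_prod_sinc_ne_zero (a : ℕ → ℝ) (k : ℕ) :
    Dense {t : ℝ | ∏ j ∈ Finset.range k, Real.sinc (a j * t) ≠ 0} := by
  have h : (⋃ j ∈ Finset.range k, {t : ℝ | Real.sinc (a j * t) = 0}).Countable :=
    (Finset.range k).countable_toSet.biUnion fun j _ ↦ countable_sinc_zeros (a j)
  convert h.dense_compl ℝ using 1
  ext t
  simp [Finset.prod_eq_zero_iff]

theorem norm_charFun_nu_le (ha : a ∈ sequences) (k : ℕ) (t : ℝ) :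
    ‖charFun (nu a : Measure ℝ) t‖ ≤
      |∏ j ∈ Finset.range k, Real.sinc (a j * t)| * |Real.sinc (a k * t)| := by
  have h := tendsto_charFun_nu (summable_of_mem_sequences ha) (tsum_le_of_mem_sequences ha) t
  refine le_of_tendsto h.norm ?_
  filter_upwards [eventually_ge_atTop (k + 1)] with n hn
  rw [Complex.norm_real, Real.norm_eq_abs, abs_mul, Real.abs_exp,
    ← Finset.prod_range_mul_prod_Ico _ hn, abs_mul, Finset.prod_range_succ, abs_mul]
  have h1 : 0 ≤ (1 - ∑' k, a k ^ 2) * t ^ 2 :=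
    mul_nonneg (by linarith [tsum_le_of_mem_sequences ha]) (sq_nonneg t)
  refine (mul_le_of_le_one_left (by positivity) (Real.exp_le_one_iff.2 (by linarith))).trans ?_
  exact mul_le_of_le_one_right (by positivity) (abs_prod_sinc_le_one a t _)

theorem exists_le_norm_charFun_nu (hb : b ∈ sequences) (k : ℕ) {t₁ : ℝ}
    (h1 : b k * t₁ < Real.pi) : ∃ c, 0 < c ∧ ∀ t ∈ Set.Ioo 0 t₁,
      |∏ j ∈ Finset.range k, Real.sinc (b j * t)| * c ≤ ‖charFun (nu b : Measure ℝ) t‖ := by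
  obtain ⟨C, hC0, hC⟩ := exists_exp_le_sinc h1
  refine ⟨Real.exp (-(t₁ ^ 2 / 6)) * Real.exp (-(C * t₁ ^ 2)), by positivity, fun t ht ↦ ?_⟩
  have h := tendsto_charFun_nu (summable_of_mem_sequences hb) (tsum_le_of_mem_sequences hb) t
  have htt : t ^ 2 ≤ t₁ ^ 2 := pow_le_pow_left₀ ht.1.le ht.2.le 2
  refine ge_of_tendsto h.norm ?_
  filter_upwards [eventually_ge_atTop k] with n hn
  rw [Complex.norm_real, Real.norm_eq_abs, abs_mul, Real.abs_exp,
    ← Finset.prod_range_mul_prod_Ico _ hn, abs_mul,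
    mul_left_comm (Real.exp (-((1 - ∑' k, b k ^ 2) * t ^ 2 / 6)))]
  refine mul_le_mul_of_nonneg_left ?_ (abs_nonneg _)
  refine mul_le_mul (Real.exp_le_exp.2 ?_) (le_trans ?_ (le_abs_self _)) (Real.exp_pos _).le
    (Real.exp_pos _).le
  · have : 0 ≤ ∑' k, b k ^ 2 := tsum_nonneg fun k ↦ sq_nonneg (b k)
    nlinarith [mul_nonneg this (sq_nonneg t)]
  · have h2 : ∏ j ∈ Finset.Ico k n, Real.exp (-(C * (b j * t) ^ 2)) ≤
        ∏ j ∈ Finset.Ico k n, Real.sinc (b j * t) := by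
      refine Finset.prod_le_prod (fun _ _ ↦ (Real.exp_pos _).le) fun j hj ↦ ?_
      refine hC _ (mul_nonneg (hb.2.1 j) ht.1.le) ?_
      exact mul_le_mul (hb.1 (Finset.mem_Ico.1 hj).1) ht.2.le ht.1.le (hb.2.1 k)
    refine le_trans ?_ h2
    rw [← Real.exp_sum]
    refine Real.exp_le_exp.2 ?_
    have h3 : ∑ j ∈ Finset.Ico k n, b j ^ 2 ≤ 1 := by
      refine le_trans (Finset.sum_le_sum_of_subset_of_nonneg ?_ fun _ _ _ ↦ sq_nonneg _) (hb.2.2 n)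
      intro j hj
      simp at hj ⊢; exact hj.2
    rw [Finset.sum_neg_distrib, neg_le_neg_iff, ← Finset.mul_sum]
    refine mul_le_mul_of_nonneg_left ?_ hC0
    simp_rw [mul_pow]
    rw [← Finset.sum_mul]
    nlinarith [sq_nonneg t]

/-- If the laws agreed, the upper bound for `a` and the lower bound for `b` would share the factors
below `k`. Cancelling them where they do not vanish, which is a dense set, gives `c ≤ |sinc (a k *
t)|` there, hence by continuity on all of `(0, t₁)`. But `t = π / a k` lies in this interval and is
a zero of the right side. -/
theorem nu_ne_of_lt (ha : a ∈ sequences) (hb : b ∈ sequences) {k : ℕ}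
    (hk : ∀ j < k, a j = b j) (hlt : b k < a k) : nu a ≠ nu b := by
  intro hnu
  have hak : 0 < a k := (hb.2.1 k).trans_lt hlt
  have hpi := Real.pi_pos
  -- Any point strictly between `π / a k` and `π / b k` will do, the latter being infinite when `b k
  -- = 0`.
  obtain ⟨t₁, ht₁, hbt⟩ : ∃ t₁, Real.pi / a k < t₁ ∧ b k * t₁ < Real.pi := by
    rcases (hb.2.1 k).eq_or_lt with h0 | h0
    · exact ⟨Real.pi / a k + 1, by linarith, by rw [← h0]; simpa using hpi⟩
    · obtain ⟨t₁, h1, h2⟩ := exists_between (div_lt_div_of_pos_left hpi h0 hlt)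
      refine ⟨t₁, h1, ?_⟩
      rw [lt_div_iff₀ h0] at h2; linarith
  obtain ⟨c, hc, hcb⟩ := exists_le_norm_charFun_nu hb k hbt
  have hsub : Set.Ioo 0 t₁ ∩ {t : ℝ | ∏ j ∈ Finset.range k, Real.sinc (a j * t) ≠ 0} ⊆
      {t | c ≤ |Real.sinc (a k * t)|} := by
    rintro t ⟨ht, hne⟩
    have h1 := hcb t ht
    have h2 : ∏ j ∈ Finset.range k, Real.sinc (b j * t) =
        ∏ j ∈ Finset.range k, Real.sinc (a j * t) :=
      Finset.prod_congr rfl fun j hj ↦ by rw [hk j (Finset.mem_range.1 hj)]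
    rw [← hnu, h2] at h1
    exact le_of_mul_le_mul_left (h1.trans (norm_charFun_nu_le ha k t)) (abs_pos.2 hne)
  have hclosed : IsClosed {t | c ≤ |Real.sinc (a k * t)|} :=
    isClosed_le continuous_const (Real.continuous_sinc.comp (by fun_prop)).abs
  have h0 : Real.pi / a k ∈ {t | c ≤ |Real.sinc (a k * t)|} :=
    closure_minimal hsub hclosed ((dense_prod_sinc_ne_zero a k).open_subset_closure_inter isOpen_Ioo
      ⟨by positivity, ht₁⟩)
  rw [Set.mem_ofPred_eq, mul_div_cancel₀ _ hak.ne', Real.sinc_of_ne_zero hpi.ne', Real.sin_pi,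
    zero_div, abs_zero] at h0
  linarith

theorem injOn_nu_sequences : Set.InjOn nu sequences := by
  intro a ha b hb hnu
  by_contra hne
  have hex : ∃ k, a k ≠ b k := Function.ne_iff.1 hne
  classical
  have hmin : ∀ j < Nat.find hex, a j = b j := fun j hj ↦ not_not.1 (Nat.find_min hex hj)
  rcases lt_or_gt_of_ne (Nat.find_spec hex) with h | h
  · exact nu_ne_of_lt hb ha (fun j hj ↦ (hmin j hj).symm) h hnu.symm
  · exact nu_ne_of_lt ha hb hmin h hnu

end sequences

/-! ### The projected measures -/

theorem uniformCube_eq_map_pi (n : ℕ) :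
    uniformCube n = (Measure.pi fun _ : Fin n ↦ uniformInterval).map (WithLp.toLp 2) := by
  have hof : (uniformCube n).map WithLp.ofLp = Measure.pi fun _ : Fin n ↦ uniformInterval := by
    refine (Measure.pi_eq fun s hs ↦ ?_).symm
    have hpre : cube n ∩ (WithLp.ofLp : EuclideanSpace ℝ (Fin n) → (Fin n → ℝ)) ⁻¹' Set.univ.pi s =
        WithLp.ofLp ⁻¹' Set.univ.pi fun i ↦ Set.Icc (-1 : ℝ) 1 ∩ s i := by
      ext u
      simp only [cube, Set.mem_inter_iff, Set.mem_ofPred_eq, Set.mem_preimage, Set.mem_univ_pi,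
        forall_and]
    have hcube : MeasurableSet (cube n) := by
      have : cube n = ⋂ i, {u | u i ∈ Set.Icc (-1 : ℝ) 1} := by ext u; simp [cube]
      rw [this]
      exact MeasurableSet.iInter fun i ↦ measurableSet_Icc.preimage (by fun_prop)
    rw [Measure.map_apply (by fun_prop) (MeasurableSet.univ_pi hs), uniformCube, cond_apply hcube,
      hpre, (PiLp.volume_preserving_ofLp (Fin n)).measure_preimage
      (MeasurableSet.univ_pi fun i ↦ measurableSet_Icc.inter (hs i)).nullMeasurableSet,
      volume_pi_pi, volume_cube]
    simp_rw [uniformInterval, cond_apply measurableSet_Icc]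
    rw [Finset.prod_mul_distrib]
    congr 1
    rw [Real.volume_Icc, Finset.prod_const, Finset.card_univ, Fintype.card_fin, ← ENNReal.inv_pow]
    norm_num
  rw [← hof, Measure.map_map (by fun_prop) (by fun_prop)]
  exact Measure.map_id.symm

theorem charFun_projectedMeasure {n : ℕ} (θ : EuclideanSpace ℝ (Fin n)) (t : ℝ) :
    charFun (projectedMeasure θ : Measure ℝ) t = ((∏ i, Real.sinc (θ i * t) : ℝ) : ℂ) := by
  have h : charFun (projectedMeasure θ : Measure ℝ) t = charFun (uniformCube n) (t • θ) := by
    rw [charFun_apply_real, charFun_apply]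
    refine (integral_map (by fun_prop) (by fun_prop)).trans ?_
    refine integral_congr_ae (ae_of_all _ fun u ↦ ?_)
    simp only [inner_smul_right, Complex.ofReal_mul]
  rw [h, uniformCube_eq_map_pi, charFun_pi]
  push_cast
  refine Finset.prod_congr rfl fun i _ ↦ ?_
  rw [charFun_uniformInterval, PiLp.smul_apply, smul_eq_mul, mul_comm]

theorem continuous_projectedMeasure (n : ℕ) :
    Continuous (projectedMeasure : EuclideanSpace ℝ (Fin n) → ProbabilityMeasure ℝ) := by
  rw [continuous_iff_seqContinuous]
  intro u θ hu
  rw [Function.comp_def, ProbabilityMeasure.tendsto_iff_tendsto_charFun]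
  intro t
  simp_rw [charFun_projectedMeasure]
  have hc : Continuous fun θ : EuclideanSpace ℝ (Fin n) ↦
      ((∏ i, Real.sinc (θ i * t) : ℝ) : ℂ) := by
    refine Complex.continuous_ofReal.comp (continuous_finsetProd _ fun k _ ↦ ?_)
    exact Real.continuous_sinc.comp (by fun_prop)
  exact (hc.tendsto θ).comp hu

/-! ### Non-increasing rearrangement -/

section rearrangement

variable {n : ℕ} (θ : EuclideanSpace ℝ (Fin n))

/-- A permutation which makes the absolute values of the coordinates non-increasing. -/
noncomputable def sortPerm : Equiv.Perm (Fin n) := Tuple.sort fun i ↦ -|θ i|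

theorem antitone_abs_sortPerm : Antitone fun i ↦ |θ (sortPerm θ i)| := fun _ _ h ↦
  neg_le_neg_iff.1 (Tuple.monotone_sort (fun i ↦ -|θ i|) h)

/-- The non-increasing rearrangement of the absolute values of the coordinates, extended by `0`. -/
noncomputable def rearrangement (k : ℕ) : ℝ := if h : k < n then |θ (sortPerm θ ⟨k, h⟩)| else 0

theorem rearrangement_coe (i : Fin n) : rearrangement θ i = |θ (sortPerm θ i)| := by
  simp [rearrangement]

theorem rearrangement_of_le {k : ℕ} (h : n ≤ k) : rearrangement θ k = 0 := by
  simp [rearrangement, h]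

theorem rearrangement_nonneg (k : ℕ) : 0 ≤ rearrangement θ k := by
  unfold rearrangement; split <;> positivity

theorem antitone_rearrangement : Antitone (rearrangement θ) := by
  intro i j hij
  rcases lt_or_ge j n with hj | hj
  · have := antitone_abs_sortPerm θ (Fin.mk_le_mk.2 hij : (⟨i, hij.trans_lt hj⟩ : Fin n) ≤ ⟨j, hj⟩)
    simpa [rearrangement, hj, hij.trans_lt hj] using this
  · rw [rearrangement_of_le θ hj]; exact rearrangement_nonneg θ i

theorem sum_rearrangement : ∑ k ∈ Finset.range n, rearrangement θ k ^ 2 = ∑ i, θ i ^ 2 := by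
  rw [← Fin.sum_univ_eq_sum_range (fun k ↦ rearrangement θ k ^ 2)]
  simp_rw [rearrangement_coe, sq_abs]
  exact Equiv.sum_comp (sortPerm θ) fun i ↦ θ i ^ 2

theorem sum_rearrangement_of_le {m : ℕ} (h : n ≤ m) :
    ∑ k ∈ Finset.range m, rearrangement θ k ^ 2 = ∑ i, θ i ^ 2 := by
  rw [← sum_rearrangement, eq_comm]
  refine Finset.sum_subset (by simpa using h) fun k _ hk ↦ ?_
  rw [rearrangement_of_le θ (by simpa using hk)]; simp

theorem prod_sinc_rearrangement {m : ℕ} (h : n ≤ m) (t : ℝ) :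
    ∏ k ∈ Finset.range m, Real.sinc (rearrangement θ k * t) = ∏ i, Real.sinc (θ i * t) := by
  have h1 : ∏ k ∈ Finset.range n, Real.sinc (rearrangement θ k * t) =
      ∏ k ∈ Finset.range m, Real.sinc (rearrangement θ k * t) := by
    refine Finset.prod_subset (by simpa using h) fun k _ hk ↦ ?_
    rw [rearrangement_of_le θ (by simpa using hk)]; simp
  rw [← h1, ← Fin.prod_univ_eq_prod_range (fun k ↦ Real.sinc (rearrangement θ k * t))]
  simp_rw [rearrangement_coe]
  rw [← Equiv.prod_comp (sortPerm θ) fun i ↦ Real.sinc (θ i * t)]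
  refine Finset.prod_congr rfl fun i _ ↦ ?_
  rcases abs_choice (θ (sortPerm θ i)) with h | h <;> rw [h]
  rw [neg_mul, Real.sinc_neg]

variable {θ}

theorem rearrangement_mem_sequences (hθ : ∑ i, θ i ^ 2 = 1) : rearrangement θ ∈ sequences := by
  refine ⟨antitone_rearrangement θ, rearrangement_nonneg θ, fun m ↦ ?_⟩
  rw [← hθ, ← sum_rearrangement_of_le θ (le_max_right m n)]
  exact Finset.sum_le_sum_of_subset_of_nonneg (by simp) fun _ _ _ ↦ sq_nonneg _

/-- The norm is one, so from `m = n` on `charApprox` is constant and equals the product of `sinc`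
factors of `θ`; permutations and signs do not affect that product. -/
theorem nu_rearrangement (hθ : ∑ i, θ i ^ 2 = 1) : nu (rearrangement θ) = projectedMeasure θ := by
  suffices h : (nu (rearrangement θ) : Measure ℝ) = projectedMeasure θ from Subtype.ext h
  refine Measure.ext_of_charFun (funext fun t ↦ ?_)
  refine tendsto_nhds_unique (tendsto_charApprox (rearrangement_mem_sequences hθ) t) ?_
  refine tendsto_const_nhds.congr' ?_
  filter_upwards [eventually_ge_atTop n] with m hm
  refine (charFun_projectedMeasure θ t).trans ?_
  rw [charApprox, sum_rearrangement_of_le θ hm, hθ, prod_sinc_rearrangement θ hm]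
  simp

theorem exists_card_eq_sum_rearrangement (θ : EuclideanSpace ℝ (Fin n)) {m : ℕ} (h : m ≤ n) :
    ∃ s : Finset (Fin n), s.card = m ∧
      ∑ k ∈ Finset.range m, rearrangement θ k ^ 2 = ∑ i ∈ s, θ i ^ 2 := by
  refine ⟨(Finset.univ.map (Fin.castLEEmb h)).map (sortPerm θ).toEmbedding, by simp, ?_⟩
  rw [← Fin.sum_univ_eq_sum_range (fun k ↦ rearrangement θ k ^ 2), Finset.sum_map, Finset.sum_map]
  refine Finset.sum_congr rfl fun i _ ↦ ?_
  have := rearrangement_coe θ (Fin.castLE h i)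
  rw [Fin.val_castLE] at this
  rw [this, sq_abs]; rfl

/-- Pigeonhole: the `k + 1` indices up to `k` cannot inject into the `k` indices below it. -/
theorem exists_le_le_perm (σ : Equiv.Perm (Fin n)) (k : Fin n) : ∃ i ≤ k, k ≤ σ i := by
  by_contra! h
  have := Finset.card_le_card_of_injOn (s := Finset.Iic k) (t := Finset.Iio k) σ
    (fun i hi ↦ by simpa using h i (by simpa using hi)) σ.injective.injOn
  simp at this

/-- Sorting does not spoil the box. Some coordinate with index at most `k` occupies a sorted
position at or after `k`, which gives the lower bound; some sorted position up to `k` holds a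
coordinate with index at least `k`, which gives the upper bound. -/
theorem rearrangement_mem_Ioo {a : ℕ → ℝ} (ha : Antitone a) (ha0 : ∀ k, 0 ≤ a k) {m : ℕ} {ε : ℝ}
    (hm : m ≤ n) (h1 : ∀ i : Fin n, (i : ℕ) < m → θ i ∈ Set.Ioo (a i) (a i + ε))
    (h2 : ∀ i : Fin n, m ≤ (i : ℕ) → |θ i| < ε) {k : ℕ} (hk : k < m) :
    rearrangement θ k ∈ Set.Ioo (a k) (a k + ε) := by
  set k' : Fin n := ⟨k, hk.trans_le hm⟩
  have hk' : rearrangement θ k = |θ (sortPerm θ k')| := rearrangement_coe θ k'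
  rw [hk']
  have hpos : ∀ i : Fin n, (i : ℕ) < m → |θ i| = θ i := fun i hi ↦
    abs_of_pos ((ha0 i).trans_lt (h1 i hi).1)
  constructor
  · obtain ⟨i, hi, hi'⟩ := exists_le_le_perm (sortPerm θ).symm k'
    have h3 := antitone_abs_sortPerm θ hi'
    simp only [Equiv.apply_symm_apply] at h3
    have him : (i : ℕ) < m := lt_of_le_of_lt (Fin.le_def.1 hi) hk
    rw [hpos i him] at h3
    exact ((ha (Fin.le_def.1 hi)).trans_lt (h1 i him).1).trans_le h3
  · obtain ⟨i, hi, hi'⟩ := exists_le_le_perm (sortPerm θ) k'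
    refine (antitone_abs_sortPerm θ hi).trans_lt ?_
    rcases lt_or_ge (sortPerm θ i : ℕ) m with him | him
    · simp only [hpos _ him]
      have : a (sortPerm θ i) ≤ a k := ha (Fin.le_def.1 hi')
      linarith [(h1 _ him).2]
    · exact (h2 _ him).trans_le (by linarith [ha0 k])

end rearrangement

/-! ### Volume estimates for the Euclidean ball -/

section volume

variable {ι : Type*} [Fintype ι]

/-- The open Euclidean ball of radius `r` in `ι → ℝ`. -/
def sqBall (ι : Type*) [Fintype ι] (r : ℝ) : Set (ι → ℝ) := {y | ∑ i, y i ^ 2 < r ^ 2}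

theorem isOpen_sqBall (r : ℝ) : IsOpen (sqBall ι r) := isOpen_lt (by fun_prop) (by fun_prop)

open scoped Pointwise in
theorem volume_sqBall {r : ℝ} (hr : 0 < r) :
    volume (sqBall ι r) = ENNReal.ofReal (r ^ Fintype.card ι) * volume (sqBall ι 1) := by
  have h : sqBall ι r = r • sqBall ι 1 := by
    ext y
    rw [Set.mem_smul_set_iff_inv_smul_mem₀ hr.ne']
    simp only [sqBall, Set.mem_ofPred_eq, Pi.smul_apply, smul_eq_mul, mul_pow, ← Finset.mul_sum]
    rw [inv_pow, inv_mul_lt_iff₀ (by positivity), one_pow, mul_one]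
  rw [h, Measure.addHaar_smul, Module.finrank_fintype_fun_eq_card, abs_of_nonneg (by positivity)]

theorem volume_sqBall_ne_zero : volume (sqBall ι 1) ≠ 0 :=
  ((isOpen_sqBall 1).measure_pos _ ⟨0, by simp [sqBall]⟩).ne'

theorem volume_sqBall_le : volume (sqBall ι 1) ≤ ENNReal.ofReal (2 ^ Fintype.card ι) := by
  have h : sqBall ι 1 ⊆ Set.univ.pi fun _ : ι ↦ Set.Icc (-1 : ℝ) 1 := by
    intro y hy i _
    have h1 : y i ^ 2 ≤ ∑ j, y j ^ 2 :=
      Finset.single_le_sum (f := fun j ↦ y j ^ 2) (fun _ _ ↦ sq_nonneg _) (Finset.mem_univ i)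
    simp only [sqBall, Set.mem_ofPred_eq, one_pow] at hy
    exact abs_le.1 ((sq_le_one_iff_abs_le_one _).1 (h1.trans hy.le))
  refine (measure_mono h).trans_eq ?_
  rw [volume_pi_pi]
  simp only [Real.volume_Icc, Finset.prod_const, Finset.card_univ]
  rw [← ENNReal.ofReal_pow (by norm_num)]
  norm_num

theorem volume_sqBall_ne_top : volume (sqBall ι 1) ≠ ∞ :=
  ne_top_of_le_ne_top ENNReal.ofReal_ne_top volume_sqBall_le

theorem volume_split [DecidableEq ι] (s : Finset ι) (A : Set ({i // i ∈ s} → ℝ))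
    (B : Set ({i // i ∉ s} → ℝ)) :
    volume {x : ι → ℝ | (fun i : {i // i ∈ s} ↦ x i) ∈ A ∧ (fun i : {i // i ∉ s} ↦ x i) ∈ B} =
      volume A * volume B := by
  have h := (volume_preserving_piEquivPiSubtypeProd (fun _ : ι ↦ ℝ) (· ∈ s)).measure_preimage_equiv
    (A ×ˢ B)
  rw [Measure.volume_eq_prod, Measure.prod_prod] at h
  convert h
  rfl

theorem sum_split [DecidableEq ι] (s : Finset ι) (f : ι → ℝ) :
    ∑ i : {i // i ∈ s}, f i + ∑ i : {i // i ∉ s}, f i = ∑ i, f i := by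
  convert Fintype.sum_subtype_add_sum_subtype (· ∈ s) f

theorem volume_sqBall_ge_split [DecidableEq ι] (s : Finset ι) {u v : ℝ} (huv : u ^ 2 + v ^ 2 ≤ 1) :
    volume (sqBall {i // i ∈ s} v) * volume (sqBall {i // i ∉ s} u) ≤ volume (sqBall ι 1) := by
  rw [← volume_split]
  refine measure_mono fun x hx ↦ ?_
  have h := sum_split s fun i ↦ x i ^ 2
  have h1 := hx.1
  have h2 := hx.2
  simp only [sqBall, Set.mem_ofPred_eq] at h1 h2 ⊢
  rw [← h]; linarith

theorem volume_sqBall_le_split [DecidableEq ι] (s : Finset ι) :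
    volume (sqBall ι 1) ≤ volume (sqBall {i // i ∈ s} 1) * volume (sqBall {i // i ∉ s} 1) := by
  rw [← volume_split]
  refine measure_mono fun x hx ↦ ?_
  have h := sum_split s fun i ↦ x i ^ 2
  have h1 : 0 ≤ ∑ i : {i // i ∈ s}, x i ^ 2 := Finset.sum_nonneg fun _ _ ↦ sq_nonneg _
  have h2 : 0 ≤ ∑ i : {i // i ∉ s}, x i ^ 2 := Finset.sum_nonneg fun _ _ ↦ sq_nonneg _
  simp only [sqBall, Set.mem_ofPred_eq] at hx ⊢
  constructor <;> linarith

end volume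

/-! ### The uniform distribution on the sphere -/

open scoped Pointwise in
-- The surface measure of `B` is, up to the factor `n`, the volume of the cone over `B` in the unit
-- ball. This turns sphere probabilities into ratios of volumes in `Fin n → ℝ`.
theorem uniformSphere_apply {n : ℕ} (hn : 1 ≤ n) {B : Set (EuclideanSpace ℝ (Fin n))}
    (hB : MeasurableSet B) :
    uniformSphere n B = volume {x : Fin n → ℝ | 0 < ∑ i, x i ^ 2 ∧ ∑ i, x i ^ 2 < 1 ∧
      WithLp.toLp 2 ((√(∑ i, x i ^ 2))⁻¹ • x) ∈ B} / volume (sqBall (Fin n) 1) := by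
  have hBs : MeasurableSet ((Subtype.val : Metric.sphere (0 : EuclideanSpace ℝ (Fin n)) 1 → _) ⁻¹' B) :=
    hB.preimage measurable_subtype_coe
  have hnorm : ∀ x : Fin n → ℝ, ‖WithLp.toLp 2 x‖ = √(∑ i, x i ^ 2) := fun x ↦ by
    rw [EuclideanSpace.norm_eq]; simp
  have hto := EuclideanSpace.volume_preserving_symm_measurableEquiv_toLp (Fin n)
  have hball : volume (Metric.ball (0 : EuclideanSpace ℝ (Fin n)) 1) = volume (sqBall (Fin n) 1) := by
    rw [← (PiLp.volume_preserving_toLp (Fin n)).measure_preimage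
      measurableSet_ball.nullMeasurableSet]
    congr 1
    ext x
    simp only [Set.mem_preimage, mem_ball_zero_iff, hnorm, sqBall, Set.mem_ofPred_eq]
    rw [Real.sqrt_lt' one_pos]
  have hcone : Set.Ioo (0 : ℝ) 1 • (Subtype.val '' ((Subtype.val :
      Metric.sphere (0 : EuclideanSpace ℝ (Fin n)) 1 → _) ⁻¹' B)) =
      {x | 0 < ‖x‖ ∧ ‖x‖ < 1 ∧ ‖x‖⁻¹ • x ∈ B} := by
    ext x
    constructor
    · rintro ⟨c, ⟨hc0, hc1⟩, _, ⟨y, hyB, rfl⟩, rfl⟩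
      have hy : ‖(y : EuclideanSpace ℝ (Fin n))‖ = 1 := mem_sphere_zero_iff_norm.1 y.2
      have hn : ‖c • (y : EuclideanSpace ℝ (Fin n))‖ = c := by
        rw [norm_smul, hy, mul_one, Real.norm_of_nonneg hc0.le]
      refine ⟨by rwa [hn], by rwa [hn], ?_⟩
      simp only [hn]
      rwa [inv_smul_smul₀ hc0.ne']
    · rintro ⟨h0, h1, h2⟩
      refine ⟨‖x‖, ⟨h0, h1⟩, ‖x‖⁻¹ • x, ⟨⟨‖x‖⁻¹ • x, ?_⟩, h2, rfl⟩, smul_inv_smul₀ h0.ne' x⟩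
      rw [mem_sphere_zero_iff_norm, norm_smul, norm_inv, norm_norm, inv_mul_cancel₀ h0.ne']
  have hDm : MeasurableSet {x : EuclideanSpace ℝ (Fin n) | 0 < ‖x‖ ∧ ‖x‖ < 1 ∧ ‖x‖⁻¹ • x ∈ B} := by
    have h : Measurable fun x : EuclideanSpace ℝ (Fin n) ↦ ‖x‖⁻¹ • x := by fun_prop
    exact (measurableSet_lt measurable_const measurable_norm).inter
      ((measurableSet_lt measurable_norm measurable_const).inter (hB.preimage h))
  have hD : volume {x : EuclideanSpace ℝ (Fin n) | 0 < ‖x‖ ∧ ‖x‖ < 1 ∧ ‖x‖⁻¹ • x ∈ B} =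
      volume {x : Fin n → ℝ | 0 < ∑ i, x i ^ 2 ∧ ∑ i, x i ^ 2 < 1 ∧
        WithLp.toLp 2 ((√(∑ i, x i ^ 2))⁻¹ • x) ∈ B} := by
    rw [← (PiLp.volume_preserving_toLp (Fin n)).measure_preimage hDm.nullMeasurableSet]
    congr 1
    ext x
    simp only [Set.mem_preimage, Set.mem_ofPred_eq, hnorm, Real.sqrt_pos, WithLp.toLp_smul]
    rw [Real.sqrt_lt' one_pos, one_pow]
  have hdim : (n : ℝ≥0∞) ≠ 0 := by exact_mod_cast (by omega : n ≠ 0)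
  rw [uniformSphere, Measure.map_apply measurable_subtype_coe hB, Measure.smul_apply,
    Measure.toSphere_apply' _ hBs, Measure.toSphere_apply_univ, hcone, hball, hD, smul_eq_mul,
    finrank_euclideanSpace_fin, mul_comm, ← div_eq_mul_inv,
    ENNReal.mul_div_mul_left _ _ hdim (ENNReal.natCast_ne_top n)]

theorem ae_uniformSphere (n : ℕ) : ∀ᵐ θ ∂uniformSphere n, ∑ i, θ i ^ 2 = 1 := by
  have hm : MeasurableSet {θ : EuclideanSpace ℝ (Fin n) | ∑ i, θ i ^ 2 = 1} :=
    measurableSet_eq_fun (by fun_prop) (by fun_prop)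
  rw [uniformSphere, ae_map_iff measurable_subtype_coe.aemeasurable hm]
  refine ae_of_all _ fun θ ↦ ?_
  have := mem_sphere_zero_iff_norm.1 θ.2
  rw [EuclideanSpace.norm_eq, Real.sqrt_eq_one] at this
  simpa using this

/-- In the cone over this event the coordinates off `s` have squared norm below `1 - q = r²`, so the
cone lies in a unit ball times an `r`-ball. The full ball contains a `v`-ball times a `u`-ball in
the same splitting, so the unknown ball volumes cancel. -/
theorem uniformSphere_sum_gt_le {n : ℕ} (hn : 1 ≤ n) (s : Finset (Fin n)) {q r u v : ℝ} (hr : 0 < r)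
    (hu : 0 < u) (hv : 0 < v) (huv : u ^ 2 + v ^ 2 ≤ 1) (hq : r ^ 2 = 1 - q) :
    uniformSphere n {θ | q < ∑ i ∈ s, θ i ^ 2} ≤
      ENNReal.ofReal (v⁻¹ ^ s.card * (r / u) ^ (n - s.card)) := by
  have hm : MeasurableSet {θ : EuclideanSpace ℝ (Fin n) | q < ∑ i ∈ s, θ i ^ 2} :=
    measurableSet_lt (by fun_prop) (by fun_prop)
  rw [uniformSphere_apply hn hm, ENNReal.div_le_iff volume_sqBall_ne_zero volume_sqBall_ne_top]
  have hcs : Fintype.card {i // i ∈ s} = s.card := by simp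
  have hcc : Fintype.card {i // i ∉ s} = n - s.card := by
    rw [Fintype.card_subtype_compl]; simp
  have h1 : volume {x : Fin n → ℝ | 0 < ∑ i, x i ^ 2 ∧ ∑ i, x i ^ 2 < 1 ∧
      WithLp.toLp 2 ((√(∑ i, x i ^ 2))⁻¹ • x) ∈
        {θ : EuclideanSpace ℝ (Fin n) | q < ∑ i ∈ s, θ i ^ 2}} ≤
      volume (sqBall {i // i ∈ s} 1) * volume (sqBall {i // i ∉ s} r) := by
    rw [← volume_split]
    refine measure_mono fun x ⟨hx0, hx1, hx2⟩ ↦ ?_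
    have h := sum_split s fun i ↦ x i ^ 2
    have h2 : ∑ i : {i // i ∈ s}, x i ^ 2 = ∑ i ∈ s, x i ^ 2 :=
      Finset.sum_coe_sort s fun i ↦ x i ^ 2
    have h3 : 0 ≤ ∑ i : {i // i ∉ s}, x i ^ 2 := Finset.sum_nonneg fun _ _ ↦ sq_nonneg _
    simp only [Set.mem_ofPred_eq, Pi.smul_apply, smul_eq_mul, mul_pow,
      ← Finset.mul_sum, inv_pow, Real.sq_sqrt hx0.le] at hx2
    rw [lt_inv_mul_iff₀ hx0] at hx2
    simp only [sqBall, Set.mem_ofPred_eq]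
    constructor
    · linarith
    · nlinarith [sq_pos_of_pos hr]
  have h2 := volume_sqBall_ge_split s huv
  rw [volume_sqBall hr] at h1
  rw [volume_sqBall hu, volume_sqBall hv] at h2
  refine h1.trans (le_trans (le_of_eq ?_) (mul_le_mul_right h2 _))
  rw [hcs, hcc]
  have h3 : ENNReal.ofReal (r ^ (n - s.card)) =
      ENNReal.ofReal (v⁻¹ ^ s.card * (r / u) ^ (n - s.card)) * ENNReal.ofReal (v ^ s.card) *
        ENNReal.ofReal (u ^ (n - s.card)) := by
    rw [← ENNReal.ofReal_mul (by positivity), ← ENNReal.ofReal_mul (by positivity)]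
    congr 1
    rw [div_pow, inv_pow]; field_simp
  rw [h3]; ring

/-- The cone contains a box in the coordinates of `s` times a shell in the others. Points there have
norm below one by `h1`, so normalizing only enlarges the coordinates: this is why the intervals are
one-sided. The inner radius `ρ₁` bounds the norm from below, and by `h2` the enlargement stays
within `a i + δ`. -/
theorem le_uniformSphere_box {n : ℕ} (hn : 1 ≤ n) (s : Finset (Fin n)) (hs : 1 ≤ n - s.card)
    {a : Fin n → ℝ} (ha : ∀ i, 0 ≤ a i) {δ δ' ρ₁ ρ₂ : ℝ} (hδ : 0 < δ') (hρ₁ : 0 < ρ₁) (hρ : ρ₁ < ρ₂)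
    (h1 : ∑ i ∈ s, (a i + δ') ^ 2 + ρ₂ ^ 2 ≤ 1)
    (h2 : ∀ i ∈ s, a i + δ' ≤ (a i + δ) * √(∑ i ∈ s, a i ^ 2 + ρ₁ ^ 2)) :
    ENNReal.ofReal ((δ' / 2) ^ s.card * ((1 - ρ₁ / ρ₂) * ρ₂ ^ (n - s.card))) ≤
      uniformSphere n {θ | ∀ i ∈ s, θ i ∈ Set.Ioo (a i) (a i + δ)} := by
  have hm : MeasurableSet {θ : EuclideanSpace ℝ (Fin n) | ∀ i ∈ s, θ i ∈ Set.Ioo (a i) (a i + δ)} := by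
    simp only [Set.ofPred_forall]
    refine MeasurableSet.iInter fun i ↦ MeasurableSet.iInter fun _ ↦ ?_
    exact measurableSet_Ioo.preimage (by fun_prop)
  rw [uniformSphere_apply hn hm,
    ENNReal.le_div_iff_mul_le (.inl volume_sqBall_ne_zero) (.inl volume_sqBall_ne_top)]
  have hcs : Fintype.card {i // i ∈ s} = s.card := by simp
  have hcc : Fintype.card {i // i ∉ s} = n - s.card := by
    rw [Fintype.card_subtype_compl]; simp
  have hρ₂ : 0 < ρ₂ := hρ₁.trans hρ
  have hbox : volume (Set.univ.pi fun i : {i // i ∈ s} ↦ Set.Ioo (a i) (a i + δ')) =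
      ENNReal.ofReal (δ' ^ s.card) := by
    rw [volume_pi_pi]
    simp [ENNReal.ofReal_pow hδ.le]
  have hshell : ENNReal.ofReal ((1 - ρ₁ / ρ₂) * ρ₂ ^ (n - s.card)) *
      volume (sqBall {i // i ∉ s} 1) ≤
      volume (sqBall {i // i ∉ s} ρ₂ \ sqBall {i // i ∉ s} ρ₁) := by
    refine le_trans ?_ le_measure_sdiff
    rw [volume_sqBall hρ₁, volume_sqBall hρ₂, ← ENNReal.sub_mul (fun _ _ ↦ volume_sqBall_ne_top),
      ← ENNReal.ofReal_sub _ (by positivity), hcc]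
    refine mul_le_mul_left (ENNReal.ofReal_le_ofReal ?_) _
    -- Since `n - s.card ≥ 1`, the inner ball takes at most the fraction `ρ₁ / ρ₂` of the outer one,
    -- uniformly in `n`.
    have h3 : ρ₁ ^ (n - s.card) ≤ ρ₁ / ρ₂ * ρ₂ ^ (n - s.card) := by
      obtain ⟨k, hk⟩ := Nat.exists_eq_add_of_le' hs
      rw [hk, pow_succ, pow_succ]
      have : ρ₁ ^ k ≤ ρ₂ ^ k := by gcongr
      have h4 : ρ₁ / ρ₂ * (ρ₂ ^ k * ρ₂) = ρ₂ ^ k * ρ₁ := by field_simp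
      rw [h4]; gcongr
    linarith
  have hsub : {x : Fin n → ℝ | (fun i : {i // i ∈ s} ↦ x i) ∈
        (Set.univ.pi fun i : {i // i ∈ s} ↦ Set.Ioo (a i) (a i + δ')) ∧
      (fun i : {i // i ∉ s} ↦ x i) ∈ sqBall {i // i ∉ s} ρ₂ \ sqBall {i // i ∉ s} ρ₁} ⊆
      {x : Fin n → ℝ | 0 < ∑ i, x i ^ 2 ∧ ∑ i, x i ^ 2 < 1 ∧
        WithLp.toLp 2 ((√(∑ i, x i ^ 2))⁻¹ • x) ∈
          {θ : EuclideanSpace ℝ (Fin n) | ∀ i ∈ s, θ i ∈ Set.Ioo (a i) (a i + δ)}} := by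
    rintro x ⟨hx1, hx2, hx3⟩
    have hx1' : ∀ i ∈ s, x i ∈ Set.Ioo (a i) (a i + δ') := fun i hi ↦ hx1 ⟨i, hi⟩ trivial
    simp only [sqBall, Set.mem_ofPred_eq, not_lt] at hx2 hx3
    have h := sum_split s fun i ↦ x i ^ 2
    have h3 : ∑ i : {i // i ∈ s}, x i ^ 2 = ∑ i ∈ s, x i ^ 2 :=
      Finset.sum_coe_sort s fun i ↦ x i ^ 2
    have h4 : ∑ i ∈ s, a i ^ 2 ≤ ∑ i ∈ s, x i ^ 2 := Finset.sum_le_sum fun i hi ↦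
      pow_le_pow_left₀ (ha i) (hx1' i hi).1.le 2
    have h5 : ∑ i ∈ s, x i ^ 2 ≤ ∑ i ∈ s, (a i + δ') ^ 2 := Finset.sum_le_sum fun i hi ↦
      pow_le_pow_left₀ ((ha i).trans (hx1' i hi).1.le) (hx1' i hi).2.le 2
    have h6 : 0 ≤ ∑ i ∈ s, a i ^ 2 := Finset.sum_nonneg fun _ _ ↦ sq_nonneg _
    have hpos : 0 < ∑ i, x i ^ 2 := by nlinarith [sq_pos_of_pos hρ₁]
    have hlt : ∑ i, x i ^ 2 < 1 := by linarith
    have hsqrt : 0 < √(∑ i, x i ^ 2) := Real.sqrt_pos.2 hpos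
    have hge : √(∑ i ∈ s, a i ^ 2 + ρ₁ ^ 2) ≤ √(∑ i, x i ^ 2) := Real.sqrt_le_sqrt (by linarith)
    have hle : √(∑ i, x i ^ 2) ≤ 1 := Real.sqrt_le_one.2 hlt.le
    refine ⟨hpos, hlt, fun i hi ↦ ?_⟩
    simp only [Pi.smul_apply, smul_eq_mul]
    have hxi := hx1' i hi
    have hδ0 : 0 < (a i + δ) := by
      have := h2 i hi
      by_contra hcon
      nlinarith [ha i, Real.sqrt_nonneg (∑ i ∈ s, a i ^ 2 + ρ₁ ^ 2)]
    constructor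
    · rw [lt_inv_mul_iff₀ hsqrt]
      nlinarith [ha i, hxi.1]
    · rw [inv_mul_lt_iff₀ hsqrt]
      have := h2 i hi
      nlinarith [hxi.2]
  refine le_trans ?_ (measure_mono hsub)
  rw [volume_split, hbox]
  refine le_trans ?_ (mul_le_mul_right hshell _)
  refine (mul_le_mul_right ((volume_sqBall_le_split s).trans
    (mul_le_mul_left volume_sqBall_le _)) _).trans (le_of_eq ?_)
  rw [hcs]
  have h3 : ENNReal.ofReal (δ' ^ s.card) =
      ENNReal.ofReal ((δ' / 2) ^ s.card) * ENNReal.ofReal (2 ^ s.card) := by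
    rw [← ENNReal.ofReal_mul (by positivity), ← mul_pow]; congr 2; ring
  rw [h3, ENNReal.ofReal_mul (by positivity)]
  ring

/-! ### Exponential estimates on the sphere -/

theorem exists_uniformSphere_sum_gt_le (m : ℕ) {q p : ℝ} (hq : q < 1) (hp : 0 < p)
    (hpq : 1 - q < p ^ 2) : ∃ C, 0 < C ∧ ∀ n : ℕ, 1 ≤ n → m ≤ n → ∀ s : Finset (Fin n), s.card = m →
      uniformSphere n {θ | q < ∑ i ∈ s, θ i ^ 2} ≤ ENNReal.ofReal (C * p ^ n) := by
  set r := √(1 - q) with hr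
  have hr0 : 0 < r := Real.sqrt_pos.2 (by linarith)
  have hrp : r < p := (Real.sqrt_lt' hp).2 hpq
  -- Taking `u` in `(r / p, 1)` gives `r / u ≤ p` and leaves room for `v`, whose contribution
  -- depends only on `m`.
  obtain ⟨u, hu1, hu2⟩ := exists_between ((div_lt_one hp).2 hrp)
  have hu0 : 0 < u := (div_pos hr0 hp).trans hu1
  have huv : 0 < 1 - u ^ 2 := by nlinarith
  have hru : r / u ≤ p := by
    rw [div_lt_iff₀ hp] at hu1
    rw [div_le_iff₀ hu0]; linarith
  set v := √(1 - u ^ 2) with hv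
  have hv0 : 0 < v := Real.sqrt_pos.2 huv
  refine ⟨v⁻¹ ^ m * (p ^ m)⁻¹, by positivity, fun n hn hmn s hs ↦ ?_⟩
  refine (uniformSphere_sum_gt_le hn s hr0 hu0 hv0 ?_ ?_).trans (ENNReal.ofReal_le_ofReal ?_)
  · rw [hv, Real.sq_sqrt huv.le]; linarith
  · rw [hr, Real.sq_sqrt (by linarith)]
  · rw [hs, mul_assoc]
    refine mul_le_mul_of_nonneg_left ?_ (by positivity)
    obtain ⟨k, rfl⟩ := Nat.exists_eq_add_of_le hmn
    rw [Nat.add_sub_cancel_left, pow_add, inv_mul_cancel_left₀ (by positivity)]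
    gcongr

/-- The `m` largest coordinates form one of at most `n ^ m` subsets; the union bound is absorbed by
the gap between `p'` and `p`. -/
theorem eventually_uniformSphere_rearrangement_le (m : ℕ) {q p : ℝ} (hq : q < 1) (hp : 0 < p)
    (hpq : 1 - q < p ^ 2) : ∀ᶠ n : ℕ in atTop,
      uniformSphere n {θ | q < ∑ k ∈ Finset.range m, rearrangement θ k ^ 2} ≤
        ENNReal.ofReal (p ^ n) := by
  obtain ⟨p', hp1, hp2⟩ := exists_between ((Real.sqrt_lt' hp).2 hpq)
  have hp0 : 0 < p' := (Real.sqrt_nonneg _).trans_lt hp1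
  obtain ⟨C, hC0, hC⟩ := exists_uniformSphere_sum_gt_le m hq hp0 ((Real.sqrt_lt' hp0).1 hp1)
  have hlim : Tendsto (fun n : ℕ ↦ C * ((n : ℝ) ^ m * (p' / p) ^ n)) atTop (𝓝 0) := by
    have h := tendsto_pow_const_mul_const_pow_of_abs_lt_one m
      (by rwa [abs_of_pos (by positivity), div_lt_one hp] : |p' / p| < 1)
    simpa using h.const_mul C
  filter_upwards [eventually_ge_atTop 1, eventually_ge_atTop m, hlim.eventually_lt_const one_pos]
    with n hn hmn hlt
  have hsub : {θ : EuclideanSpace ℝ (Fin n) | q < ∑ k ∈ Finset.range m, rearrangement θ k ^ 2} ⊆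
      ⋃ s ∈ Finset.univ.powersetCard m, {θ | q < ∑ i ∈ s, θ i ^ 2} := by
    intro θ hθ
    obtain ⟨s, hs, hsum⟩ := exists_card_eq_sum_rearrangement θ hmn
    rw [Set.mem_ofPred_eq, hsum] at hθ
    exact Set.mem_biUnion (x := s) (by simpa [Finset.mem_powersetCard] using hs) hθ
  refine (measure_mono hsub).trans ((measure_biUnion_finset_le _ _).trans ?_)
  have hle : ∀ s ∈ (Finset.univ : Finset (Fin n)).powersetCard m,
      uniformSphere n {θ | q < ∑ i ∈ s, θ i ^ 2} ≤ ENNReal.ofReal (C * p' ^ n) := fun s hs ↦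
    hC n hn hmn s (Finset.mem_powersetCard.1 hs).2
  refine (Finset.sum_le_card_nsmul _ _ _ hle).trans ?_
  rw [Finset.card_powersetCard, Finset.card_univ, Fintype.card_fin, nsmul_eq_mul,
    ← ENNReal.ofReal_natCast, ← ENNReal.ofReal_mul (by positivity)]
  refine ENNReal.ofReal_le_ofReal ?_
  have h1 : ((n.choose m : ℕ) : ℝ) ≤ (n : ℝ) ^ m := by exact_mod_cast Nat.choose_le_pow n m
  have h2 : C * ((n : ℝ) ^ m * (p' / p) ^ n) * p ^ n ≤ 1 * p ^ n := by gcongr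
  rw [div_pow] at h2
  have h3 : C * ((n : ℝ) ^ m * (p' ^ n / p ^ n)) * p ^ n = (n : ℝ) ^ m * (C * p' ^ n) := by
    field_simp
  calc _ ≤ (n : ℝ) ^ m * (C * p' ^ n) := by gcongr
    _ ≤ _ := by linarith

/-- The box alone has rate close to `√(1 - A)`. If another coordinate has size at least `ε`, then `m
+ 1` coordinates carry more than `q > A`, and these at most `n` events have a strictly smaller rate.
-/
theorem eventually_le_uniformSphere {a : ℕ → ℝ} (ha : ∀ k, 0 ≤ a k) {m : ℕ} {p ε : ℝ}
    (hε : 0 < ε) (hp : 0 < p) (hpa : p ^ 2 < 1 - ∑ k ∈ Finset.range m, a k ^ 2) :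
    ∀ᶠ n : ℕ in atTop, ENNReal.ofReal (p ^ n) ≤
      uniformSphere n {θ | (∀ i : Fin n, (i : ℕ) < m → θ i ∈ Set.Ioo (a i) (a i + ε)) ∧
        ∀ i : Fin n, m ≤ (i : ℕ) → |θ i| < ε} := by
  set A := ∑ k ∈ Finset.range m, a k ^ 2 with hA
  have hA0 : 0 ≤ A := Finset.sum_nonneg fun _ _ ↦ sq_nonneg _
  have hA1 : 0 < 1 - A := (by positivity : (0 : ℝ) ≤ p ^ 2).trans_lt hpa
  set ρ := √(1 - A) with hρ
  have hρ0 : 0 < ρ := Real.sqrt_pos.2 hA1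
  have hρsq : ρ ^ 2 = 1 - A := Real.sq_sqrt hA1.le
  -- The bound `ε / 2` makes `ε' < ε`, and `ρ / 2` ensures `q < 1`.
  set ε' := min (ε / 2) (ρ / 2) with hε'
  have hε'0 : 0 < ε' := by positivity
  have hε'1 : ε' ≤ ε / 2 := min_le_left _ _
  have hε'2 : ε' ≤ ρ / 2 := min_le_right _ _
  set q := A + ε' ^ 2 with hq
  have hq1 : q < 1 := by nlinarith
  have hpρ : p < ρ := Real.lt_sqrt_of_sq_lt hpa
  have hqρ : √(1 - q) < ρ := Real.sqrt_lt_sqrt (by linarith) (by nlinarith [pow_pos hε'0 2])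
  -- Close enough to `ρ` to exceed both the target rate `p` and the rate of the bad events, and to
  -- keep normalization inside the box.
  obtain ⟨ρ₁, hρ₁, hpρ₁, hqρ₁, hg⟩ : ∃ ρ₁, ρ₁ < ρ ∧ p < ρ₁ ∧ √(1 - q) < ρ₁ ∧
      (∀ k ∈ Finset.range m, a k < (a k + ε) * √(A + ρ₁ ^ 2)) := by
    have hg : ∀ k ∈ Finset.range m, ∀ᶠ x in 𝓝[<] ρ, a k < (a k + ε) * √(A + x ^ 2) := by
      intro k _
      have hc : Continuous fun x : ℝ ↦ (a k + ε) * √(A + x ^ 2) := by fun_prop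
      have h1 : a k < (a k + ε) * √(A + ρ ^ 2) := by rw [hρsq]; simp [hε]
      exact nhdsWithin_le_nhds ((hc.tendsto ρ).eventually_const_lt h1)
    have hlt : ∀ {x : ℝ}, x < ρ → ∀ᶠ y in 𝓝[<] ρ, x < y := fun h ↦
      nhdsWithin_le_nhds (lt_mem_nhds h)
    exact (eventually_mem_nhdsWithin.and ((hlt hpρ).and ((hlt hqρ).and
      ((Finset.eventually_all _).2 hg)))).exists
  have hρ₁0 : 0 < ρ₁ := hp.trans hpρ₁
  obtain ⟨ρ₂, hρ₂, hρ₂ρ⟩ := exists_between hρ₁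
  have hρ₂0 : 0 < ρ₂ := hρ₁0.trans hρ₂
  have hρ₂1 : ρ₂ ≤ 1 := hρ₂ρ.le.trans (Real.sqrt_le_one.2 (by linarith))
  obtain ⟨δ, hδ0, hδ1, hδ2⟩ : ∃ δ, 0 < δ ∧ ∑ k ∈ Finset.range m, (a k + δ) ^ 2 + ρ₂ ^ 2 < 1 ∧
      ∀ k ∈ Finset.range m, a k + δ < (a k + ε) * √(A + ρ₁ ^ 2) := by
    have h1 : ∀ᶠ δ in 𝓝[>] (0 : ℝ), ∑ k ∈ Finset.range m, (a k + δ) ^ 2 + ρ₂ ^ 2 < 1 := by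
      have hc : Continuous fun δ : ℝ ↦ ∑ k ∈ Finset.range m, (a k + δ) ^ 2 + ρ₂ ^ 2 := by fun_prop
      refine nhdsWithin_le_nhds ((hc.tendsto 0).eventually_lt_const ?_)
      simp only [add_zero]
      nlinarith
    have h2 : ∀ k ∈ Finset.range m, ∀ᶠ δ in 𝓝[>] (0 : ℝ), a k + δ < (a k + ε) * √(A + ρ₁ ^ 2) := by
      intro k hk
      have hc : Continuous fun δ : ℝ ↦ a k + δ := by fun_prop
      refine nhdsWithin_le_nhds ((hc.tendsto 0).eventually_lt_const ?_)
      simpa using hg k hk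
    exact (eventually_mem_nhdsWithin.and (h1.and ((Finset.eventually_all _).2 h2))).exists
  obtain ⟨C, hC0, hC⟩ := exists_uniformSphere_sum_gt_le (m + 1) hq1 hρ₁0
    ((Real.sqrt_lt' hρ₁0).1 hqρ₁)
  -- Relative to `ρ₂ ^ n`, the bad events (at most `n * C * ρ₁ ^ n`) and the target (at most `ρ₁ ^
  -- n`) are jointly negligible.
  have hlim : Tendsto (fun n : ℕ ↦ C * ((n : ℝ) ^ 1 * (ρ₁ / ρ₂) ^ n) +
      (n : ℝ) ^ 0 * (ρ₁ / ρ₂) ^ n) atTop (𝓝 0) := by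
    have hr : |ρ₁ / ρ₂| < 1 := by rwa [abs_of_pos (by positivity), div_lt_one hρ₂0]
    simpa using ((tendsto_pow_const_mul_const_pow_of_abs_lt_one 1 hr).const_mul C).add
      (tendsto_pow_const_mul_const_pow_of_abs_lt_one 0 hr)
  have hK : 0 < (δ / 2) ^ m * (1 - ρ₁ / ρ₂) :=
    mul_pos (by positivity) (by rw [sub_pos, div_lt_one hρ₂0]; exact hρ₂)
  filter_upwards [eventually_ge_atTop (m + 1), hlim.eventually_lt_const hK] with n hn hlt
  set s : Finset (Fin n) := Finset.univ.filter fun i ↦ (i : ℕ) < m with hs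
  have hsmem : ∀ i : Fin n, i ∈ s ↔ (i : ℕ) < m := fun i ↦ by simp [hs]
  have hseq : s = Finset.univ.map (Fin.castLEEmb (by omega : m ≤ n)) := by
    ext i
    rw [hsmem]
    simp only [Finset.mem_map, Finset.mem_univ, true_and, Fin.castLEEmb_apply]
    exact ⟨fun h ↦ ⟨⟨i, h⟩, rfl⟩, by rintro ⟨j, rfl⟩; exact j.2⟩
  have hscard : s.card = m := by rw [hseq]; simp
  have hssum : ∀ f : ℕ → ℝ, ∑ i ∈ s, f i = ∑ k ∈ Finset.range m, f k := fun f ↦ by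
    rw [hseq, Finset.sum_map, ← Fin.sum_univ_eq_sum_range]; rfl
  have hlow := le_uniformSphere_box (n := n) (by omega) s (by omega) (a := fun i ↦ a i) (δ := ε)
    (fun i ↦ ha i) hδ0 hρ₁0 hρ₂ (by rw [hssum fun k ↦ (a k + δ) ^ 2]; exact hδ1.le)
    (fun i hi ↦ by
      rw [hssum fun k ↦ a k ^ 2]
      exact (hδ2 i (Finset.mem_range.2 ((hsmem i).1 hi))).le)
  have hsub : {θ : EuclideanSpace ℝ (Fin n) | ∀ i ∈ s, θ i ∈ Set.Ioo (a i) (a i + ε)} ⊆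
      {θ | (∀ i : Fin n, (i : ℕ) < m → θ i ∈ Set.Ioo (a i) (a i + ε)) ∧
        ∀ i : Fin n, m ≤ (i : ℕ) → |θ i| < ε} ∪
      ⋃ j ∈ sᶜ, {θ | q < ∑ i ∈ insert j s, θ i ^ 2} := by
    intro θ hθ
    by_cases h : ∀ i : Fin n, m ≤ (i : ℕ) → |θ i| < ε
    · exact .inl ⟨fun i hi ↦ hθ i ((hsmem i).2 hi), h⟩
    · push Not at h
      obtain ⟨j, hj, hjε⟩ := h
      have hjs : j ∉ s := fun h ↦ by rw [hsmem] at h; omega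
      refine .inr (Set.mem_biUnion (x := j) (by simpa using hjs) ?_)
      rw [Set.mem_ofPred_eq, Finset.sum_insert hjs]
      have h1 : A ≤ ∑ i ∈ s, θ i ^ 2 := by
        rw [hA, ← hssum]
        exact Finset.sum_le_sum fun i hi ↦ pow_le_pow_left₀ (ha i) (hθ i hi).1.le 2
      have h2 : ε' ^ 2 < θ j ^ 2 := by
        rw [← sq_abs (θ j)]
        exact pow_lt_pow_left₀ (by linarith) hε'0.le two_ne_zero
      linarith
  have hbad : uniformSphere n (⋃ j ∈ sᶜ, {θ | q < ∑ i ∈ insert j s, θ i ^ 2}) ≤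
      ENNReal.ofReal (n * (C * ρ₁ ^ n)) := by
    refine (measure_biUnion_finset_le _ _).trans ?_
    have hle : ∀ j ∈ sᶜ, uniformSphere n {θ | q < ∑ i ∈ insert j s, θ i ^ 2} ≤
        ENNReal.ofReal (C * ρ₁ ^ n) := fun j hj ↦ by
      refine hC n (by omega) (by omega) _ ?_
      rw [Finset.card_insert_of_notMem (by simpa using hj), hscard]
    refine (Finset.sum_le_card_nsmul _ _ _ hle).trans ?_
    rw [nsmul_eq_mul, ENNReal.ofReal_mul (Nat.cast_nonneg n), ENNReal.ofReal_natCast]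
    gcongr
    simpa using Finset.card_le_univ sᶜ
  refine ENNReal.le_of_add_le_add_right (a := ENNReal.ofReal (n * (C * ρ₁ ^ n)))
    ENNReal.ofReal_ne_top ?_
  refine le_trans ?_ (hlow.trans ((measure_mono hsub).trans
    ((measure_union_le _ _).trans (add_le_add_right hbad _))))
  rw [← ENNReal.ofReal_add (by positivity) (by positivity), hscard]
  refine ENNReal.ofReal_le_ofReal ?_
  have h1 : p ^ n ≤ ρ₁ ^ n := by gcongr
  have h2 : ρ₂ ^ n ≤ ρ₂ ^ (n - m) := pow_le_pow_of_le_one hρ₂0.le hρ₂1 (Nat.sub_le _ _)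
  have h3 := mul_le_mul hlt.le h2 (by positivity) hK.le
  have h4 : (C * ((n : ℝ) ^ 1 * (ρ₁ / ρ₂) ^ n) + (n : ℝ) ^ 0 * (ρ₁ / ρ₂) ^ n) * ρ₂ ^ n =
      n * (C * ρ₁ ^ n) + ρ₁ ^ n := by
    rw [div_pow]; field_simp
  rw [h4] at h3
  linarith

/-! ### The rate function -/

/-- The rate of a sequence: `-½ log (1 - ‖a‖₂²)`, with the value `∞` if `‖a‖₂ ≥ 1`. -/
noncomputable def energy (a : ℕ → ℝ) : ℝ≥0∞ :=
  if ∑' k, a k ^ 2 < 1 then ENNReal.ofReal (-(1 / 2) * Real.log (1 - ∑' k, a k ^ 2)) else ∞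

theorem energy_le_iff {a : ℕ → ℝ} {c : ℝ} (hc : 0 ≤ c) :
    energy a ≤ ENNReal.ofReal c ↔ ∑' k, a k ^ 2 ≤ 1 - Real.exp (-(2 * c)) := by
  have he := Real.exp_pos (-(2 * c))
  unfold energy
  split_ifs with h
  · rw [ENNReal.ofReal_le_ofReal_iff hc]
    have h1 : Real.exp (-(2 * c)) ≤ 1 - ∑' k, a k ^ 2 ↔ -(2 * c) ≤ Real.log (1 - ∑' k, a k ^ 2) :=
      (Real.le_log_iff_exp_le (by linarith)).symm
    rw [le_sub_comm, h1]
    constructor <;> intro <;> linarith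
  · simp only [top_le_iff, ENNReal.ofReal_ne_top, false_iff, not_le]
    linarith

/-- The rate function: the push-forward of `energy` along `nu`. -/
noncomputable def rate (ν : ProbabilityMeasure ℝ) : ℝ≥0∞ :=
  ⨅ a ∈ {a ∈ sequences | nu a = ν}, energy a

theorem rate_nu {a : ℕ → ℝ} (ha : a ∈ sequences) : rate (nu a) = energy a := by
  have : {b ∈ sequences | nu b = nu a} = {a} := by
    ext b
    exact ⟨fun h ↦ injOn_nu_sequences h.1 ha h.2, by rintro rfl; exact ⟨ha, rfl⟩⟩
  rw [rate, this, iInf_singleton]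

theorem exists_of_rate_ne_top {ν : ProbabilityMeasure ℝ} (h : rate ν ≠ ∞) :
    ∃ a ∈ admissible, ν = nu a := by
  by_contra! hne
  refine h ?_
  simp only [rate, iInf_eq_top]
  rintro a ⟨ha, rfl⟩
  unfold energy
  refine if_neg fun hlt ↦ ?_
  exact hne a (mem_admissible_of_mem_sequences ha hlt) rfl

/-- Stating the norm bound through partial sums exhibits the sublevel set as the image of a closed
subset of `sequences`, hence as a compact set. -/
theorem setOf_rate_le {c : ℝ} (hc : 0 ≤ c) : {ν | rate ν ≤ ENNReal.ofReal c} =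
    nu '' {a ∈ sequences | ∀ n, ∑ k ∈ Finset.range n, a k ^ 2 ≤ 1 - Real.exp (-(2 * c))} := by
  have key : ∀ a ∈ sequences, (energy a ≤ ENNReal.ofReal c ↔
      ∀ n, ∑ k ∈ Finset.range n, a k ^ 2 ≤ 1 - Real.exp (-(2 * c))) := fun a ha ↦ by
    have hs := summable_of_mem_sequences ha
    rw [energy_le_iff hc]
    exact ⟨fun h n ↦ (hs.sum_le_tsum _ fun _ _ ↦ sq_nonneg _).trans h,
      fun h ↦ hs.tsum_le_of_sum_range_le h⟩
  ext ν
  constructor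
  · intro h
    obtain ⟨a, ha, rfl⟩ := exists_of_rate_ne_top (ne_top_of_le_ne_top ENNReal.ofReal_ne_top h)
    have ha := mem_sequences_of_mem_admissible ha
    rw [Set.mem_ofPred_eq, rate_nu ha] at h
    exact ⟨a, ⟨ha, (key a ha).1 h⟩, rfl⟩
  · rintro ⟨a, ⟨ha, h⟩, rfl⟩
    rw [Set.mem_ofPred_eq, rate_nu ha]
    exact (key a ha).2 h

theorem isCompact_image_nu {s : Set (ℕ → ℝ)} (hs : IsClosed s) : IsCompact (nu '' {a ∈ sequences | a ∈ s}) := by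
  have h : IsCompact {a ∈ sequences | a ∈ s} := isCompact_sequences.inter_right hs
  exact h.image_of_continuousOn
    ((continuousOn_iff_continuous_domRestrict.2 continuous_nu_sequences).mono fun _ h ↦ h.1)

theorem isCompact_setOf_rate_le {c : ℝ} (hc : 0 ≤ c) : IsCompact {ν | rate ν ≤ ENNReal.ofReal c} := by
  rw [setOf_rate_le hc]
  refine isCompact_image_nu (s := {a | ∀ n, ∑ k ∈ Finset.range n, a k ^ 2 ≤ 1 - Real.exp (-(2 * c))}) ?_
  simp only [Set.ofPred_forall]
  exact isClosed_iInter fun n ↦ isClosed_le (by fun_prop) (by fun_prop)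

theorem isGood_rate : IsGood rate := fun c ↦ by
  have h := isCompact_setOf_rate_le c.coe_nonneg
  rwa [ENNReal.ofReal_coe_nnreal] at h

theorem lowerSemicontinuous_rate : LowerSemicontinuous rate := by
  rw [lowerSemicontinuous_iff_isClosed_preimage]
  intro y
  induction y with
  | top => simp
  | coe c => exact (isGood_rate c).isClosed

/-! ### The large deviation bounds -/

theorem log_ofReal_exp_pow_div {n : ℕ} (hn : 1 ≤ n) (c : ℝ) :
    ENNReal.log (ENNReal.ofReal (Real.exp (-c) ^ n)) / ((n : ℝ) : EReal) = (-c : ℝ) := by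
  rw [ENNReal.log_ofReal_of_pos (by positivity), Real.log_pow, Real.log_exp, ← EReal.coe_div]
  have : (n : ℝ) ≠ 0 := by positivity
  congr 1
  field_simp

theorem exists_lt_sum_of_lt_energy {a : ℕ → ℝ} (ha : a ∈ sequences) {c : ℝ}
    (h : (c : EReal) < (energy a : EReal)) :
    ∃ n, 1 - Real.exp (-(2 * c)) < ∑ k ∈ Finset.range n, a k ^ 2 := by
  have hs := summable_of_mem_sequences ha
  suffices hlt : 1 - Real.exp (-(2 * c)) < ∑' k, a k ^ 2 from
    (hs.hasSum.tendsto_sum_nat.eventually_const_lt hlt).exists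
  -- For negative `c` the threshold is negative, and `energy_le_iff` does not apply.
  rcases lt_or_ge c 0 with hc | hc
  · have h1 : 1 < Real.exp (-(2 * c)) := Real.one_lt_exp_iff.2 (by linarith)
    have h2 : 0 ≤ ∑' k, a k ^ 2 := tsum_nonneg fun _ ↦ sq_nonneg _
    linarith
  · by_contra! hle
    have h3 := EReal.coe_ennreal_le_coe_ennreal_iff.2 ((energy_le_iff hc).2 hle)
    rw [EReal.coe_ennreal_ofReal, max_eq_left hc] at h3
    exact absurd h (not_lt.2 h3)

/-- For each sequence over `F` some partial sum exceeds the threshold. These open conditions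
increase with `n`, so compactness of the preimage of `F` gives one `n` for all. -/
theorem exists_forall_lt_sum {F : Set (ProbabilityMeasure ℝ)} (hF : IsClosed F) {c : ℝ}
    (h : ∀ ν ∈ F, (c : EReal) < (rate ν : EReal)) :
    ∃ n, ∀ a ∈ sequences, nu a ∈ F → 1 - Real.exp (-(2 * c)) < ∑ k ∈ Finset.range n, a k ^ 2 := by
  set U : ℕ → Set sequences := fun n ↦ {a | 1 - Real.exp (-(2 * c)) < ∑ k ∈ Finset.range n, a.1 k ^ 2}
  have hU : Monotone U := fun n m hnm a ha ↦ LT.lt.trans_le (show _ < ∑ k ∈ Finset.range n, a.1 k ^ 2 from ha)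
    (Finset.sum_le_sum_of_subset_of_nonneg (Finset.range_subset_range.2 hnm) fun _ _ _ ↦ sq_nonneg _)
  have : CompactSpace sequences := isCompact_iff_compactSpace.1 isCompact_sequences
  obtain ⟨n, hn⟩ := (hF.preimage continuous_nu_sequences).isCompact.elim_directed_cover U
    (fun n ↦ isOpen_lt continuous_const (continuous_finsetSum _ fun k _ ↦
      ((continuous_apply k).comp continuous_subtype_val).pow 2)) (fun a ha ↦ by
      have h1 := h _ ha
      rw [rate_nu a.2] at h1
      exact Set.mem_iUnion.2 (exists_lt_sum_of_lt_energy a.2 h1)) hU.directed_le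
  exact ⟨n, fun a ha haF ↦ hn (show (⟨a, ha⟩ : sequences) ∈ _ from haF)⟩

/-- Otherwise a sequence of counterexamples would converge coordinatewise to `a`, against continuity
of `nu`. One-sided intervals suffice, which matches the box estimate on the sphere. -/
theorem exists_forall_nu_mem {G : Set (ProbabilityMeasure ℝ)} (hG : IsOpen G) {a : ℕ → ℝ}
    (ha : a ∈ sequences) (haG : nu a ∈ G) :
    ∃ (m : ℕ) (ε : ℝ), 0 < ε ∧
      ∀ b ∈ sequences, (∀ k < m, b k ∈ Set.Ioo (a k) (a k + ε)) → nu b ∈ G := by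
  by_contra! hcon
  choose b hb hlt hnot using fun m : ℕ ↦ hcon m (1 / ((m : ℝ) + 1)) (by positivity)
  have hlim : Tendsto (fun m ↦ (⟨b m, hb m⟩ : sequences)) atTop (𝓝 ⟨a, ha⟩) := by
    rw [tendsto_subtype_rng, tendsto_pi_nhds]
    intro k
    have h1 : Tendsto (fun m : ℕ ↦ a k + 1 / ((m : ℝ) + 1)) atTop (𝓝 (a k)) := by
      simpa using (tendsto_one_div_add_atTop_nhds_zero_nat (𝕜 := ℝ)).const_add (a k)
    refine tendsto_of_tendsto_of_tendsto_of_le_of_le' tendsto_const_nhds h1 ?_ ?_ <;>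
      filter_upwards [eventually_gt_atTop k] with m hm
    · exact (hlt m k hm).1.le
    · exact (hlt m k hm).2.le
  have := ((continuous_nu_sequences.tendsto ⟨a, ha⟩).comp hlim).eventually (hG.mem_nhds haG)
  obtain ⟨m, hm⟩ := this.exists
  exact hnot m hm

theorem measurable_projectedMeasure (n : ℕ) :
    Measurable[_, borel _] (projectedMeasure : EuclideanSpace ℝ (Fin n) → ProbabilityMeasure ℝ) :=
  @measurable_generateFrom _ _ _ {s | IsOpen s} _ fun _ hs ↦
    (IsOpen.preimage (continuous_projectedMeasure n) hs).measurableSet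

/-- With `q = 1 - exp (-2c')` and `p = exp (-c)`, the requirement `1 - q < p ^ 2` is exactly `c <
c'`. -/
theorem eventually_uniformSphere_le {A : Set (ProbabilityMeasure ℝ)} {c c' : ℝ} (hc : c < c')
    (h : ∀ ν ∈ closure A, (c' : EReal) < (rate ν : EReal)) :
    ∀ᶠ n : ℕ in atTop, uniformSphere n (projectedMeasure ⁻¹' A) ≤
      ENNReal.ofReal (Real.exp (-c) ^ n) := by
  obtain ⟨m, hm⟩ := exists_forall_lt_sum isClosed_closure h
  filter_upwards [eventually_uniformSphere_rearrangement_le m (q := 1 - Real.exp (-(2 * c')))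
    (p := Real.exp (-c)) (by linarith [Real.exp_pos (-(2 * c'))]) (Real.exp_pos _) (by
      rw [sub_sub_cancel, ← Real.exp_nat_mul]
      exact Real.exp_lt_exp.2 (by push_cast; linarith))] with n hn
  refine (measure_mono_ae ?_).trans hn
  filter_upwards [ae_uniformSphere n] with θ hθ hθA
  refine hm _ (rearrangement_mem_sequences hθ) ?_
  rw [nu_rearrangement hθ]
  exact subset_closure hθA

theorem eventually_le_uniformSphere_preimage {A : Set (ProbabilityMeasure ℝ)} {a : ℕ → ℝ}
    (ha : a ∈ admissible) (haA : nu a ∈ interior A) {c : ℝ} (hc : (rate (nu a) : EReal) < c) :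
    ∀ᶠ n : ℕ in atTop, ENNReal.ofReal (Real.exp (-c) ^ n) ≤
      uniformSphere n (projectedMeasure ⁻¹' A) := by
  have has := mem_sequences_of_mem_admissible ha
  obtain ⟨m, ε, hε, hG⟩ := exists_forall_nu_mem isOpen_interior has haA
  have hexp : Real.exp (-c) ^ 2 < 1 - ∑ k ∈ Finset.range m, a k ^ 2 := by
    have h1 : ∑ k ∈ Finset.range m, a k ^ 2 ≤ ∑' k, a k ^ 2 :=
      ha.2.2.1.sum_le_tsum _ fun _ _ ↦ sq_nonneg _
    refine lt_of_lt_of_le ?_ (sub_le_sub_left h1 1)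
    rw [rate_nu has, energy, if_pos ha.2.2.2, EReal.coe_ennreal_ofReal, EReal.coe_lt_coe_iff] at hc
    have h2 := (le_max_left _ _).trans_lt hc
    rw [← Real.exp_nat_mul, ← Real.lt_log_iff_exp_lt (by linarith [ha.2.2.2])]
    push_cast
    linarith
  filter_upwards [eventually_le_uniformSphere ha.2.1 hε (Real.exp_pos (-c)) hexp,
    eventually_ge_atTop m] with n hn hmn
  refine hn.trans (measure_mono_ae ?_)
  filter_upwards [ae_uniformSphere n] with θ hθ hθE
  refine interior_subset ?_
  rw [← nu_rearrangement hθ]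
  exact hG _ (rearrangement_mem_sequences hθ) fun k hk ↦
    rearrangement_mem_Ioo ha.1 ha.2.1 hmn hθE.1 hθE.2 hk

theorem satisfiesLDP_projectedMeasure (Ω : ℕ → Type*) [∀ n, MeasurableSpace (Ω n)]
    (P : ∀ n, Measure (Ω n)) (Θ : ∀ n, Ω n → EuclideanSpace ℝ (Fin n))
    (hΘ : ∀ n, 1 ≤ n → HasLaw (Θ n) (uniformSphere n) (P n)) :
    SatisfiesLDP P (fun n ω ↦ projectedMeasure (Θ n ω)) (fun n ↦ (n : ℝ)) rate := by
  have hlaw : ∀ A : Set (ProbabilityMeasure ℝ), MeasurableSet[borel _] A → ∀ n, 1 ≤ n →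
      P n ((fun ω ↦ projectedMeasure (Θ n ω)) ⁻¹' A) =
        uniformSphere n (projectedMeasure ⁻¹' A) := fun A hA n hn ↦ by
    rw [← (hΘ n hn).map_eq, Measure.map_apply_of_aemeasurable (hΘ n hn).aemeasurable
      (measurable_projectedMeasure n hA)]
    rfl
  have hdiv : ∀ n : ℕ, Monotone fun x : ℝ≥0∞ ↦ ENNReal.log x / ((n : ℝ) : EReal) := fun n x y h ↦
    EReal.monotone_div_right_of_nonneg (by positivity) (ENNReal.log_monotone h)
  refine ⟨fun n hn ↦ ?_, fun n hn ↦ by positivity, Nat.mono_cast, tendsto_natCast_atTop_atTop,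
    lowerSemicontinuous_rate, fun A hA ↦ ?_, fun A hA ↦ ?_⟩
  · exact @Measurable.comp_aemeasurable _ _ _ _ (borel _) _ _ _ _ (measurable_projectedMeasure n)
      (hΘ n hn).aemeasurable
  · rw [EReal.neg_le]
    refine le_iInf₂ fun ν hν ↦ ?_
    rw [← EReal.le_of_forall_lt_iff_le]
    intro c hc
    rw [EReal.neg_le]
    -- A real `c` above the rate makes the rate finite, so `ν` comes from a sequence of norm below
    -- one.
    obtain ⟨a, ha, rfl⟩ := exists_of_rate_ne_top (ν := ν) (by rintro h; simp [h] at hc)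
    refine le_liminf_of_le (by isBoundedDefault) ?_
    filter_upwards [eventually_le_uniformSphere_preimage ha hν hc, eventually_ge_atTop 1] with n hn h1
    rw [hlaw A hA n h1, ← EReal.coe_neg, ← log_ofReal_exp_pow_div h1 c]
    exact hdiv n hn
  · refine EReal.le_neg_of_le_neg ?_
    rw [← EReal.ge_of_forall_gt_iff_ge]
    intro c hc
    refine EReal.le_neg_of_le_neg ?_
    obtain ⟨c', hc1, hc2⟩ := EReal.lt_iff_exists_real_btwn.1 hc
    have h : ∀ ν ∈ closure A, (c' : EReal) < (rate ν : EReal) := fun ν hν ↦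
      hc2.trans_le (iInf₂_le ν hν)
    refine limsup_le_of_le (by isBoundedDefault) ?_
    filter_upwards [eventually_uniformSphere_le (EReal.coe_lt_coe_iff.1 hc1) h,
      eventually_ge_atTop 1] with n hn h1
    rw [hlaw A hA n h1, ← EReal.coe_neg, ← log_ofReal_exp_pow_div h1 c]
    exact hdiv n hn

end CubeProjection

theorem theoremA :
    (∀ α ∈ CubeProjection.admissible, ∀ᵐ ω ∂CubeProjection.jointLaw,
      ∃ l : ℝ, Tendsto (fun n ↦ CubeProjection.partialSum α n ω) atTop (𝓝 l)) ∧
    ∃ I : ProbabilityMeasure ℝ → ℝ≥0∞,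
      (∀ α ∈ CubeProjection.admissible,
        I (CubeProjection.nu α) = ENNReal.ofReal (-(1 / 2) * Real.log (1 - ∑' k, α k ^ 2))) ∧
      (∀ ν : ProbabilityMeasure ℝ,
        (¬ ∃ α ∈ CubeProjection.admissible, ν = CubeProjection.nu α) → I ν = ∞) ∧
      CubeProjection.IsGood I ∧
      ∀ (Ω : ℕ → Type*) [∀ n, MeasurableSpace (Ω n)] (P : ∀ n, Measure (Ω n))
        [∀ n, IsProbabilityMeasure (P n)] (Θ : ∀ n, Ω n → EuclideanSpace ℝ (Fin n)),
        (∀ n, 1 ≤ n → HasLaw (Θ n) (CubeProjection.uniformSphere n) (P n)) →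
        CubeProjection.SatisfiesLDP P (fun n ω ↦ CubeProjection.projectedMeasure (Θ n ω))
          (fun n ↦ (n : ℝ)) I := by
  refine ⟨fun α hα ↦ CubeProjection.ae_tendsto_partialSum hα.2.2.1, CubeProjection.rate,
    fun α hα ↦ ?_, fun ν hν ↦ ?_, CubeProjection.isGood_rate, fun Ω _ P _ Θ hΘ ↦
      CubeProjection.satisfiesLDP_projectedMeasure Ω P Θ hΘ⟩
  · rw [CubeProjection.rate_nu (CubeProjection.mem_sequences_of_mem_admissible hα),
      CubeProjection.energy, if_pos hα.2.2.2]
  · by_contra h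
    exact hν (CubeProjection.exists_of_rate_ne_top h)
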